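/- **Lemma (Commutator Lemma).** Conventions. Let $\mathscr{H}$ be a separable complex Hilbert space. For a compact operator $T$ on $\mathscr{H}$ let $\mu_0(T)\ge\mu_1(T)\ge\cdots$ be its singular values, i.e., $\mu_j(T)$ is the $(j+1)$-th eigenvalue of $|T|=\sqrt{T^*T}$ counted with multiplicity; equivalently $\mu_j(T)=\min\{\|T-R\|:\ R\in\mathscr{L}(\mathscr{H}),\ \operatorname{rk}R\le j\}$. For $r>0$ the weak Schatten class $\mathscr{L}_{r,\infty}$ consists of the compact operators $T$ with $\mu_j(T)=\operatorname{O}(j^{-1/r})$, and it is equipped with the quasi-norm $\|T\|_{r,\infty}=\sup_{j\ge 0}(j+1)^{1/r}\mu_j(T)$. A spectral triple $(\mathscr{A},\mathscr{H},D)$ consists of a unital $*$-algebra $\mathscr{A}$ (over $\mathbb{C}$) represented by bounded operators on $\mathscr{H}$ and a selfadjoint unbounded operator $D$ on $\mathscr{H}$ with compact resolvent such that, for every $a\in\mathscr{A}$, we have $a(\operatorname{dom}D)\subseteq\operatorname{dom}D$ and $[D,a]$ is bounded on $\operatorname{dom}D$; its continuous extension to $\mathscr{H}$ is again denoted by $[D,a]$.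 The partial inverse $D^{-1}$ is the bounded operator which vanishes on $\ker D$ and inverts $D$ on $(\ker D)^\perp$. The triple is $p$-summable, $p>0$, if $D^{-1}\in\mathscr{L}_{p,\infty}$. For $q>0$, the operator $|D|^{-q}$ is defined by functional calculus with the convention that it vanishes on $\ker D$; that is, if $D\xi=\lambda\xi$, then $|D|^{-q}\xi=|\lambda|^{-q}\xi$ if $\lambda\ne 0$, and $|D|^{-q}\xi=0$ if $\lambda=0$. Statement. Let $p>0$ and let $(\mathscr{A},\mathscr{H},D)$ be a $p$-summable spectral triple. Given any $q>0$, for all $a\in\mathscr{A}$ we have $$\big[|D|^{-q},a\big]\in\mathscr{L}_{p/(q+1),\infty}.$$ Moreover, there is a constant $C_{D,q}>0$, which depends only on $D$ and $q$ (and on $p$), but not on the algebra $\mathscr{A}$, its representation or $a$, such that $$\big\|\big[|D|^{-q},a\big]\big\|_{p/(q+1),\infty}\le C_{D,q}\,\big\|[D,a]\big\|\qquad\forall a\in\mathscr{A}.$$ -/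

import Mathlib

noncomputable section

namespace SpectralTriple

open scoped InnerProductSpace

variable {H : Type*} [NormedAddCommGroup H] [InnerProductSpace ℂ H]

/-! ### Weak Schatten classes -/

/-- The `j`-th singular value (`j = 0, 1, …`) of a bounded operator, by the min-max principle:
`μ_j(T) = min {‖T - R‖ : rk R ≤ j}`.  For compact `T` this is the `(j+1)`-th eigenvalue of `|T|`,
counted with multiplicity. -/
def singularValue (T : H →L[ℂ] H) (j : ℕ) : ℝ :=
  ⨅ R : {R : H →L[ℂ] H // LinearMap.rank (R : H →ₗ[ℂ] H) ≤ (j : Cardinal)}, ‖T - R.1‖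

/-- The weak Schatten class `ℒ_{r,∞}`: compact operators with `μ_j(T) = O(j^{-1/r})`. -/
def MemWeakSchatten (r : ℝ) (T : H →L[ℂ] H) : Prop :=
  IsCompactOperator T ∧
    (fun j : ℕ => singularValue T j) =O[Filter.atTop] fun j : ℕ => (j : ℝ) ^ (-(1 / r))

/-- The quasi-norm `‖T‖_{r,∞} = sup_j (j+1)^{1/r} μ_j(T)` of `ℒ_{r,∞}`; the supremum is finite
whenever `MemWeakSchatten r T` holds. -/
def weakSchattenNorm (r : ℝ) (T : H →L[ℂ] H) : ℝ :=
  ⨆ j : ℕ, ((j : ℝ) + 1) ^ (1 / r) * singularValue T j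

/-! ### Unbounded operators -/

/-- The unbounded operator `D` has compact resolvent: `(D - z)⁻¹` exists as a compact operator for
some `z`. -/
def HasCompactResolvent (D : H →ₗ.[ℂ] H) : Prop :=
  ∃ (z : ℂ) (R : H →L[ℂ] H), IsCompactOperator R ∧
    (∀ x : D.domain, R (D x - z • (x : H)) = x) ∧
    ∀ y : H, ∃ x : D.domain, (x : H) = R y ∧ D x - z • (x : H) = y

/-- The kernel of `D` as a subspace of `H`. -/
def kernel (D : H →ₗ.[ℂ] H) : Submodule ℂ H :=
  (LinearMap.ker D.toFun).map D.domain.subtype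

/-- The domain of the restriction of `D` to the orthogonal complement of its kernel. -/
def coreDomain (D : H →ₗ.[ℂ] H) : Submodule ℂ H := D.domain ⊓ (kernel D)ᗮ

/-- The restriction of `D` to the orthogonal complement of its kernel. -/
def coreMap (D : H →ₗ.[ℂ] H) : coreDomain D →ₗ[ℂ] H :=
  D.toFun ∘ₗ Submodule.inclusion inf_le_left

/-- The map `(k, u) ↦ k + D u` on `ker D × (dom D ∩ (ker D)ᗮ)`. -/
def coreSum (D : H →ₗ.[ℂ] H) : (kernel D × coreDomain D) →ₗ[ℂ] H :=
  (kernel D).subtype.coprod (coreMap D)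

/-- The partial inverse `D⁻¹` as a bounded operator: the continuous extension to `H` of
`k + D u ↦ u`, for `k ∈ ker D` and `u ∈ dom D ∩ (ker D)ᗮ`. -/
def partialInverse [CompleteSpace H] (D : H →ₗ.[ℂ] H) : H →L[ℂ] H :=
  ((coreDomain D).subtype ∘ₗ LinearMap.snd ℂ (kernel D) (coreDomain D)).extendOfNorm (coreSum D)

/-- `|D|^{-q}` (`q > 0`) for selfadjoint `D` with compact resolvent, vanishing on `ker D`: the
operator `f(D⁻¹)` with `f(t) = |t|^q`, where `D⁻¹` is the partial inverse. -/
def absNegPow [CompleteSpace H] (D : H →ₗ.[ℂ] H) (q : ℝ) : H →L[ℂ] H :=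
  cfc (fun t : ℝ => |t| ^ q) (partialInverse D)

/-- The commutator `[D, a] = D a - a D` on its natural domain
`{x ∈ dom D : a x ∈ dom D}`. -/
def commutator (D : H →ₗ.[ℂ] H) (a : H →L[ℂ] H) : H →ₗ.[ℂ] H where
  domain := D.domain ⊓ D.domain.comap (a : H →ₗ[ℂ] H)
  toFun :=
    D.toFun ∘ₗ ((a : H →ₗ[ℂ] H).restrict
        (p := D.domain ⊓ D.domain.comap (a : H →ₗ[ℂ] H)) (q := D.domain) fun _ hx => hx.2) -
      (a : H →ₗ[ℂ] H) ∘ₗ D.toFun ∘ₗ Submodule.inclusion inf_le_left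

/-- The continuous extension to `H` of the commutator `[D, a]`, when the latter is densely defined
and bounded. -/
def boundedCommutator [CompleteSpace H] (D : H →ₗ.[ℂ] H) (a : H →L[ℂ] H) : H →L[ℂ] H :=
  (commutator D a).toFun.extendOfNorm (commutator D a).domain.subtype

/-! ### Spectral triples -/

/-- `(A, H, D)` is a spectral triple, the unital `*`-algebra `A` being represented on the Hilbert
space `H` by `π`. -/
structure IsSpectralTriple [CompleteSpace H] {A : Type*} [Ring A] [StarRing A] [Algebra ℂ A]
    [StarModule ℂ A] (π : A →⋆ₐ[ℂ] (H →L[ℂ] H)) (D : H →ₗ.[ℂ] H) : Prop where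
  isSelfAdjoint : IsSelfAdjoint D
  hasCompactResolvent : HasCompactResolvent D
  mapsTo_domain : ∀ a : A, ∀ x ∈ D.domain, π a x ∈ D.domain
  bounded_commutator : ∀ a : A, ∃ C : ℝ, ∀ x : (commutator D (π a)).domain,
    ‖commutator D (π a) x‖ ≤ C * ‖(x : H)‖

/-- `p`-summability: the partial inverse `D⁻¹` is in `ℒ_{p,∞}`. -/
def IsSummable [CompleteSpace H] (p : ℝ) (D : H →ₗ.[ℂ] H) : Prop :=
  MemWeakSchatten p (partialInverse D)

/-! ### The partial inverse, the powers and the commutators are well defined -/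

section WellDefined

theorem mem_kernel {D : H →ₗ.[ℂ] H} {x : H} :
    x ∈ kernel D ↔ ∃ h : x ∈ D.domain, D ⟨x, h⟩ = 0 := by
  simp [kernel, LinearMap.mem_ker]

theorem commutator_apply (D : H →ₗ.[ℂ] H) (a : H →L[ℂ] H) (x : (commutator D a).domain) :
    commutator D a x = D ⟨a x, x.2.2⟩ - a (D ⟨x, x.2.1⟩) := rfl

variable [CompleteSpace H]

theorem inner_map_eq {D : H →ₗ.[ℂ] H} (hD : IsSelfAdjoint D) (x y : D.domain) :
    ⟪D x, (y : H)⟫_ℂ = ⟪(x : H), D y⟫_ℂ := by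
  have h := LinearPMap.adjoint_isFormalAdjoint (T := D) hD.dense_domain
  rw [LinearPMap.isSelfAdjoint_def.mp hD] at h
  exact h x y

theorem mem_kernel_of_orthogonal_range {D : H →ₗ.[ℂ] H} (hD : IsSelfAdjoint D) {y : H}
    (hy : ∀ x : D.domain, ⟪y, D x⟫_ℂ = 0) : y ∈ kernel D := by
  have hyd : y ∈ D.adjoint.domain :=
    LinearPMap.mem_adjoint_domain_of_exists (T := D) y ⟨0, fun x => by simp [hy x]⟩
  have h0 : D.adjoint ⟨y, hyd⟩ = 0 :=
    LinearPMap.adjoint_apply_eq hD.dense_domain ⟨y, hyd⟩ fun x => by simp [hy x]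
  have key : ∀ T : H →ₗ.[ℂ] H, T = D → (∃ h : y ∈ T.domain, T ⟨y, h⟩ = 0) → y ∈ kernel D := by
    rintro T rfl h
    exact mem_kernel.2 h
  exact key _ (LinearPMap.isSelfAdjoint_def.mp hD) ⟨hyd, h0⟩

theorem inner_kernel_map {D : H →ₗ.[ℂ] H} (hD : IsSelfAdjoint D) {k : H} (hk : k ∈ kernel D)
    (x : D.domain) : ⟪k, D x⟫_ℂ = 0 := by
  obtain ⟨h, hk0⟩ := mem_kernel.1 hk
  have := inner_map_eq hD ⟨k, h⟩ x
  rw [hk0, inner_zero_left] at this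
  exact this.symm

theorem isClosed_kernel {D : H →ₗ.[ℂ] H} (hD : IsSelfAdjoint D) :
    IsClosed (kernel D : Set H) := by
  have : (kernel D : Set H) = ⋂ x : D.domain, {y : H | ⟪y, D x⟫_ℂ = 0} := by
    ext y
    simp only [Set.mem_iInter, Set.mem_ofPred_eq, SetLike.mem_coe]
    exact ⟨fun h x => inner_kernel_map hD h x, mem_kernel_of_orthogonal_range hD⟩
  rw [this]
  exact isClosed_iInter fun x => isClosed_eq (by fun_prop) continuous_const

/-- The range of `(k, u) ↦ k + D u` is dense in `H`. -/
theorem denseRange_coreSum {D : H →ₗ.[ℂ] H} (hD : IsSelfAdjoint D) :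
    DenseRange (coreSum D) := by
  have hK := isClosed_kernel hD
  have : CompleteSpace (kernel D) := hK.completeSpace_coe
  have h : (LinearMap.range (coreSum D)).topologicalClosure = ⊤ := by
    rw [Submodule.topologicalClosure_eq_top_iff, Submodule.eq_bot_iff]
    intro y hy
    rw [Submodule.mem_orthogonal'] at hy
    have hy1 : y ∈ (kernel D)ᗮ := by
      rw [Submodule.mem_orthogonal']
      intro k hk
      exact hy k ⟨(⟨k, hk⟩, 0), by simp [coreSum]⟩
    have hy2 : y ∈ kernel D := by
      refine mem_kernel_of_orthogonal_range hD fun x => ?_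
      set k : H := (kernel D).starProjection (x : H) with hk
      have hkm : k ∈ kernel D := Submodule.starProjection_apply_mem _ _
      obtain ⟨hkd, hk0⟩ := mem_kernel.1 hkm
      have hu : (x : H) - k ∈ coreDomain D :=
        ⟨D.domain.sub_mem x.2 hkd, Submodule.sub_starProjection_mem_orthogonal _⟩
      refine hy _ ⟨(0, ⟨(x : H) - k, hu⟩), ?_⟩
      have h1 : D (x - ⟨k, hkd⟩) = D x := by rw [LinearPMap.map_sub, hk0, sub_zero]
      have h2 : coreMap D ⟨(x : H) - k, hu⟩ = D (x - ⟨k, hkd⟩) := rfl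
      simp [coreSum, h2, h1]
    have := (Submodule.mem_orthogonal' _ _).1 hy1 y hy2
    exact inner_self_eq_zero.1 this
  have := Submodule.dense_iff_topologicalClosure_eq_top.2 h
  rwa [LinearMap.coe_range] at this

/-- Zero is not an accumulation point of the spectrum of `D`. -/
theorem exists_bound_coreMap {D : H →ₗ.[ℂ] H} (hD : IsSelfAdjoint D)
    (hR : HasCompactResolvent D) :
    ∃ C : ℝ, ∀ u : coreDomain D, ‖(u : H)‖ ≤ C * ‖coreMap D u‖ := by
  by_contra! hcon
  obtain ⟨z, R, hRc, hR1, -⟩ := hR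
  have h1 : ∀ n : ℕ, ∃ v : coreDomain D, ‖(v : H)‖ = 1 ∧ ‖coreMap D v‖ ≤ 1 / ((n : ℝ) + 1) := by
    intro n
    obtain ⟨u, hu⟩ := hcon (n + 1)
    have hn : (0 : ℝ) < n + 1 := by positivity
    have hu0 : 0 < ‖(u : H)‖ := lt_of_le_of_lt (by positivity) hu
    refine ⟨((‖(u : H)‖⁻¹ : ℝ) : ℂ) • u, ?_, ?_⟩
    · rw [Submodule.coe_smul, norm_smul, Complex.norm_real, norm_inv, norm_norm,
        inv_mul_cancel₀ hu0.ne']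
    · rw [map_smul, norm_smul, Complex.norm_real, norm_inv, norm_norm, inv_mul_eq_div,
        div_le_div_iff₀ hu0 hn]
      linarith
  choose v hv1 hv2 using h1
  have hcpt := hRc.isCompact_closure_image_closedBall (1 + ‖z‖)
  have hmem : ∀ n, (v n : H) ∈ closure (R '' Metric.closedBall 0 (1 + ‖z‖)) := by
    intro n
    refine subset_closure ⟨coreMap D (v n) - z • (v n : H), ?_, hR1 ⟨v n, (v n).2.1⟩⟩
    rw [mem_closedBall_zero_iff]
    refine (norm_sub_le _ _).trans (add_le_add ((hv2 n).trans ?_) ?_)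
    · rw [div_le_one (by positivity)]
      linarith [(Nat.cast_nonneg n : (0 : ℝ) ≤ n)]
    · rw [norm_smul, hv1, mul_one]
  obtain ⟨w, -, φ, hφ, hw⟩ := hcpt.tendsto_subseq hmem
  have hDv : Filter.Tendsto (fun n => coreMap D (v (φ n))) Filter.atTop (nhds 0) := by
    have : Filter.Tendsto (fun n => coreMap D (v n)) Filter.atTop (nhds 0) :=
      squeeze_zero_norm hv2 tendsto_one_div_add_atTop_nhds_zero_nat
    exact this.comp hφ.tendsto_atTop
  have hg : (w, (0 : H)) ∈ D.graph := by
    have hcl : IsClosed (D.graph : Set (H × H)) := hD.isClosed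
    refine hcl.mem_of_tendsto (hw.prodMk_nhds hDv) (Filter.Eventually.of_forall fun n => ?_)
    exact D.mem_graph ⟨v (φ n), (v (φ n)).2.1⟩
  have hwk : w ∈ kernel D := by
    obtain ⟨y, hy1, hy2⟩ := (LinearPMap.mem_graph_iff D).1 hg
    simp only at hy1 hy2
    exact mem_kernel.2 ⟨hy1 ▸ y.2, by subst hy1; exact hy2⟩
  have hwo : w ∈ (kernel D)ᗮ :=
    (Submodule.isClosed_orthogonal _).mem_of_tendsto hw
      (Filter.Eventually.of_forall fun n => (v (φ n)).2.2)
  have hw0 : w = 0 := inner_self_eq_zero.1 ((Submodule.mem_orthogonal' _ _).1 hwo w hwk)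
  have hw1 : ‖w‖ = 1 :=
    tendsto_nhds_unique hw.norm (by simp [hv1])
  simp [hw0] at hw1

theorem exists_bound_coreSum {D : H →ₗ.[ℂ] H} (hD : IsSelfAdjoint D)
    (hR : HasCompactResolvent D) :
    ∃ C : ℝ, ∀ x : kernel D × coreDomain D,
      ‖((coreDomain D).subtype ∘ₗ LinearMap.snd ℂ (kernel D) (coreDomain D)) x‖ ≤
        C * ‖coreSum D x‖ := by
  obtain ⟨C, hC⟩ := exists_bound_coreMap hD hR
  refine ⟨max C 0, fun x => ?_⟩
  have h1 : ‖coreMap D x.2‖ ≤ ‖coreSum D x‖ := by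
    have horth : ⟪(x.1 : H), coreMap D x.2⟫_ℂ = 0 := inner_kernel_map hD x.1.2 ⟨x.2, x.2.2.1⟩
    have h := norm_add_sq_eq_norm_sq_add_norm_sq_of_inner_eq_zero _ _ horth
    have h' : coreSum D x = (x.1 : H) + coreMap D x.2 := by simp [coreSum]
    rw [h']
    nlinarith [norm_nonneg (x.1 : H), norm_nonneg (coreMap D x.2),
      norm_nonneg ((x.1 : H) + coreMap D x.2)]
  calc ‖(x.2 : H)‖ ≤ C * ‖coreMap D x.2‖ := hC x.2
    _ ≤ max C 0 * ‖coreMap D x.2‖ :=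
      mul_le_mul_of_nonneg_right (le_max_left _ _) (norm_nonneg _)
    _ ≤ max C 0 * ‖coreSum D x‖ := mul_le_mul_of_nonneg_left h1 (le_max_right _ _)

theorem partialInverse_coreSum {D : H →ₗ.[ℂ] H} (hD : IsSelfAdjoint D)
    (hR : HasCompactResolvent D) (x : kernel D × coreDomain D) :
    partialInverse D (coreSum D x) = (x.2 : H) :=
  LinearMap.extendOfNorm_eq (denseRange_coreSum hD) (exists_bound_coreSum hD hR) x

/-- `D⁻¹` vanishes on `ker D`. -/
theorem partialInverse_kernel {D : H →ₗ.[ℂ] H} (hD : IsSelfAdjoint D)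
    (hR : HasCompactResolvent D) {k : H} (hk : k ∈ kernel D) : partialInverse D k = 0 := by
  simpa [coreSum] using partialInverse_coreSum hD hR (⟨k, hk⟩, 0)

/-- `D⁻¹ D u = u` for `u ∈ dom D ∩ (ker D)ᗮ`. -/
theorem partialInverse_map {D : H →ₗ.[ℂ] H} (hD : IsSelfAdjoint D)
    (hR : HasCompactResolvent D) {u : H} (hu : u ∈ D.domain) (hu' : u ∈ (kernel D)ᗮ) :
    partialInverse D (D ⟨u, hu⟩) = u := by
  have h := partialInverse_coreSum hD hR (0, ⟨u, hu, hu'⟩)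
  have h' : coreSum D (0, ⟨u, hu, hu'⟩) = D ⟨u, hu⟩ := by
    simp [coreSum]; rfl
  rwa [h'] at h

theorem isSelfAdjoint_partialInverse {D : H →ₗ.[ℂ] H} (hD : IsSelfAdjoint D)
    (hR : HasCompactResolvent D) : IsSelfAdjoint (partialInverse D) := by
  rw [ContinuousLinearMap.isSelfAdjoint_iff_isSymmetric]
  intro x y
  have hd := denseRange_coreSum hD
  refine hd.induction_on₂ (p := fun x y => ⟪partialInverse D x, y⟫_ℂ = ⟪x, partialInverse D y⟫_ℂ)
    (isClosed_eq (by fun_prop) (by fun_prop)) (fun s t => ?_) x y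
  rw [partialInverse_coreSum hD hR, partialInverse_coreSum hD hR]
  have e : ∀ x : kernel D × coreDomain D, coreSum D x = (x.1 : H) + D ⟨x.2, x.2.2.1⟩ := fun x => by
    simp [coreSum]; rfl
  rw [e, e, inner_add_right, inner_add_left, (Submodule.mem_orthogonal' _ _).1 s.2.2.2 _ t.1.2,
    (Submodule.mem_orthogonal _ _).1 t.2.2.2 _ s.1.2, zero_add, zero_add]
  exact (inner_map_eq hD ⟨s.2, s.2.2.1⟩ ⟨t.2, t.2.2.1⟩).symm

theorem cfc_apply_eigenvector {T : H →L[ℂ] H} (hT : IsSelfAdjoint T) {f : ℝ → ℝ}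
    (hf : Continuous f) {m : ℝ} {x : H} (hx : T x = (m : ℂ) • x) :
    cfc f T x = ((f m : ℝ) : ℂ) • x := by
  rcases eq_or_ne x 0 with rfl | hx0
  · simp
  have hm : m ∈ spectrum ℝ T := by
    intro hu
    obtain ⟨S, hS⟩ := hu
    have h1 : (S : H →L[ℂ] H) x = 0 := by
      rw [hS]
      simp [hx, Algebra.algebraMap_eq_smul_one]
    have h2 : ((↑S⁻¹ : H →L[ℂ] H) * (S : H →L[ℂ] H)) x = 0 := by
      rw [mul_apply_eq_comp, h1, map_zero]
    rw [Units.inv_mul] at h2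
    exact hx0 h2
  rw [cfc_apply f T hT hf.continuousOn]
  have key : ∀ g : C(spectrum ℝ T, ℝ), cfcHom hT g x = ((g ⟨m, hm⟩ : ℝ) : ℂ) • x := by
    intro g
    induction g using ContinuousMap.induction_on_of_compact with
    | const r =>
      have : ContinuousMap.const (spectrum ℝ T) r = algebraMap ℝ C(spectrum ℝ T, ℝ) r := rfl
      rw [this, AlgHomClass.commutes]
      simp [Algebra.algebraMap_eq_smul_one]
    | id =>
      rw [cfcHom_id]
      simpa using hx
    | star_id =>
      rw [map_star, cfcHom_id, hT.star_eq]
      simpa using hx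
    | add f g hf hg =>
      rw [map_add, add_apply, hf, hg]
      simp [add_smul]
    | mul f g hf hg =>
      rw [map_mul, mul_apply_eq_comp, hg, map_smul, hf,
        ContinuousMap.mul_apply, Complex.ofReal_mul, smul_smul, mul_comm]
    | frequently f h =>
      have hcl : IsClosed {g : C(spectrum ℝ T, ℝ) |
          cfcHom hT g x = ((g ⟨m, hm⟩ : ℝ) : ℂ) • x} := by
        have hc := cfcHom_continuous (R := ℝ) hT
        refine isClosed_eq ?_ ?_
        · exact (ContinuousLinearMap.apply ℂ H x).continuous.comp hc
        · exact (Complex.continuous_ofReal.comp (continuous_eval_const _)).smul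
            continuous_const
      exact hcl.closure_subset (mem_closure_iff_frequently.2 h)
  exact key _

/-- On eigenvectors `|D|^{-q}` acts by `|l|^{-q}`, and by `0` if the eigenvalue `l` is `0`. -/
theorem absNegPow_eigenvector {D : H →ₗ.[ℂ] H} (hD : IsSelfAdjoint D)
    (hR : HasCompactResolvent D) {q : ℝ} (hq : 0 < q) (x : D.domain) (l : ℝ)
    (hx : D x = (l : ℂ) • (x : H)) :
    absNegPow D q x = if l = 0 then 0 else ((|l| ^ (-q) : ℝ) : ℂ) • (x : H) := by
  have hB := isSelfAdjoint_partialInverse hD hR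
  have hf : Continuous fun t : ℝ => |t| ^ q := continuous_abs.rpow_const fun _ => Or.inr hq.le
  split_ifs with hl
  · have hk : (x : H) ∈ kernel D := mem_kernel.2 ⟨x.2, by simpa [hl] using hx⟩
    have h := cfc_apply_eigenvector hB hf (m := 0) (x := (x : H))
      (by simp [partialInverse_kernel hD hR hk])
    simpa [absNegPow, Real.zero_rpow hq.ne'] using h
  · have hl' : (l : ℂ) ≠ 0 := by exact_mod_cast hl
    have ho : (x : H) ∈ (kernel D)ᗮ := by
      rw [Submodule.mem_orthogonal]
      intro k hk
      have h := inner_kernel_map hD hk x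
      rw [hx, inner_smul_right] at h
      exact (mul_eq_zero.1 h).resolve_left hl'
    have h1 := partialInverse_map hD hR x.2 ho
    have h2 : partialInverse D (x : H) = ((l⁻¹ : ℝ) : ℂ) • (x : H) := by
      have h3 : (l : ℂ) • partialInverse D (x : H) = x := by
        rw [← map_smul, ← hx]; exact h1
      rw [Complex.ofReal_inv, eq_inv_smul_iff₀ hl', h3]
    have h := cfc_apply_eigenvector hB hf h2
    rw [absNegPow, h, abs_inv, Real.inv_rpow (abs_nonneg l), Real.rpow_neg (abs_nonneg l)]

/-- In a spectral triple the bounded operator `[D, a]` is given by `D a - a D` on `dom D`. -/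
theorem boundedCommutator_apply {A : Type*} [Ring A] [StarRing A] [Algebra ℂ A]
    [StarModule ℂ A] {π : A →⋆ₐ[ℂ] (H →L[ℂ] H)} {D : H →ₗ.[ℂ] H} (h : IsSpectralTriple π D)
    (a : A) (x : D.domain) :
    boundedCommutator D (π a) x =
      D ⟨π a x, h.mapsTo_domain a x x.2⟩ - π a (D x) := by
  have hdom : (commutator D (π a)).domain = D.domain :=
    inf_eq_left.2 fun x hx => h.mapsTo_domain a x hx
  have hdense : DenseRange (commutator D (π a)).domain.subtype := by
    have : Dense ((commutator D (π a)).domain : Set H) := by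
      rw [hdom]; exact h.isSelfAdjoint.dense_domain
    simpa [DenseRange] using this
  exact LinearMap.extendOfNorm_eq hdense (h.bounded_commutator a)
    ⟨x, x.2, h.mapsTo_domain a x x.2⟩

end WellDefined

end SpectralTriple

end

/-! Write `B` for the partial inverse of `D`, `P` for the projection onto `ker D` and `E` for `[D,
a]`; then `|D|^{-q} = |B|^q`. Up to kernel terms `[B, a] = -B E B`, so the commutator of `|B|^q`
with `a` should be as small as `|B|^{q+1}`, with `‖E‖` as a factor.

This is made precise on compressions. If an idempotent `Q` of norm at most one commutes with `B`,
satisfies `Q P = P Q = 0` and `‖B Q‖ ≤ ε`, then `‖Q [|B|^q, a] Q‖ ≤ C ε^{q+1} ‖E‖` with `C`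
depending only on `q` (`compression_lie_partialInverse_sq`,
`exists_norm_compression_lie_absPow_le`). For exponents below 2, `|B|^r` is an integral of
resolvents of `B²`, whose compressed commutators are explicit; larger exponents follow by the
Leibniz rule.

To reach singular values, let `Q` project onto the orthogonal complement of `ker D` and of all
eigenvectors of `B` with eigenvalue of modulus above `ε`. If `μ_j(B) < ε`, this removes at most `d +
j` dimensions, where `d` bounds `dim ker D`, so the compression bounds `μ_n` for `n ≥ 2(d + j)`
(`singularValue_lie_absNegPow_le`). Taking `ε` of order `j^{-1/p}` gives the decay `n^{-(q+1)/p}`.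
The finitely many remaining `n` need a norm bound free of `‖a‖`, available because `E` also controls
the off-diagonal blocks of `a` relative to `ker D` (`exists_norm_lie_absNegPow_le`). -/

noncomputable section

namespace SpectralTriple

open scoped InnerProductSpace
open MeasureTheory Set

/-! ### Compressed commutators with resolvents and powers in a C*-algebra -/

section CStar

variable {A : Type*} [CStarAlgebra A]

/-- Resolvent identity for commutators. -/
theorem lie_eq_of_mul_eq_one {R : Type*} [Ring R] {r s b : R} (h₁ : r * s = 1) (h₂ : s * r = 1) :
    ⁅r, b⁆ = -(r * ⁅s, b⁆ * r) := by
  have : r * ⁅s, b⁆ * r = (r * s) * b * r - r * b * (s * r) := by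
    rw [Ring.lie_def]; noncomm_ring
  rw [this, h₁, h₂, Ring.lie_def]; noncomm_ring

/-- The resolvent `(t + B²)⁻¹` of the square of a selfadjoint element. -/
def sqResolvent (B : A) (t : ℝ) : A := cfc (fun x : ℝ => (t + x ^ 2)⁻¹) B

theorem sqResolvent_mul {B : A} (hB : IsSelfAdjoint B) {t : ℝ} (ht : 0 < t) :
    sqResolvent B t * (algebraMap ℝ A t + B ^ 2) = 1 := by
  have hc : Continuous fun x : ℝ => (t + x ^ 2)⁻¹ :=
    (by fun_prop : Continuous fun x : ℝ => t + x ^ 2).inv₀ fun x => by positivity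
  have h : algebraMap ℝ A t + B ^ 2 = cfc (fun x : ℝ => t + x ^ 2) B := by
    rw [cfc_const_add .., cfc_pow_id ..]
  rw [h, sqResolvent, ← cfc_mul _ _ _ hc.continuousOn, ← cfc_one ℝ B]
  refine cfc_congr fun x _ => ?_
  exact inv_mul_cancel₀ (by positivity)

theorem mul_sqResolvent {B : A} (hB : IsSelfAdjoint B) {t : ℝ} (ht : 0 < t) :
    (algebraMap ℝ A t + B ^ 2) * sqResolvent B t = 1 := by
  have h : Commute (sqResolvent B t) (algebraMap ℝ A t + B ^ 2) :=
    Commute.cfc_real ((show Commute B (algebraMap ℝ A t) from (Algebra.commutes t B).symm).add_right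
      (Commute.pow_right rfl 2)) _
  rw [← h.eq, sqResolvent_mul hB ht]

theorem norm_sqResolvent_le {B : A} {t : ℝ} (ht : 0 < t) : ‖sqResolvent B t‖ ≤ t⁻¹ := by
  refine norm_cfc_le (by positivity) fun x _ => ?_
  rw [Real.norm_of_nonneg (by positivity)]
  gcongr
  nlinarith [sq_nonneg x]

theorem norm_sqResolvent_mul_sq_le {B : A} (hB : IsSelfAdjoint B) {t : ℝ} (ht : 0 < t) :
    ‖sqResolvent B t * B ^ 2‖ ≤ 1 := by
  have hc : Continuous fun x : ℝ => (t + x ^ 2)⁻¹ :=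
    (by fun_prop : Continuous fun x : ℝ => t + x ^ 2).inv₀ fun x => by positivity
  rw [sqResolvent, ← cfc_pow_id (R := ℝ) B 2, ← cfc_mul _ _ _ hc.continuousOn]
  refine norm_cfc_le zero_le_one fun x _ => ?_
  rw [Real.norm_of_nonneg (by positivity), inv_mul_le_one₀ (by positivity)]
  linarith

theorem commute_sqResolvent {B Q : A} (hBQ : Commute B Q) (t : ℝ) :
    Commute (sqResolvent B t) Q := Commute.cfc_real hBQ _

variable {B Q a E : A} {ε : ℝ}

theorem norm_sq_mul_le (hBQ : Commute B Q) (hQ : IsIdempotentElem Q) (hε : ‖B * Q‖ ≤ ε) :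
    ‖B ^ 2 * Q‖ ≤ ε ^ 2 := by
  have h : B ^ 2 * Q = (B * Q) * (B * Q) := by
    rw [mul_assoc B Q, ← mul_assoc Q B Q, ← hBQ.eq, mul_assoc B Q Q, hQ.eq, sq, mul_assoc]
  rw [h, sq]
  exact (norm_mul_le _ _).trans (by gcongr; exact (norm_nonneg _).trans hε)

/-- The trivial bounds `1` and `ε² / t` are each sufficient on one side of `t = ε²`. Merging them
into one expression matches the integrand of `ε^{2α}`, so that the integral over `t` is known
exactly. -/
theorem norm_sqResolvent_mul_sq_mul_le (hB : IsSelfAdjoint B) (hBQ : Commute B Q)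
    (hQ : IsIdempotentElem Q) (hQ1 : ‖Q‖ ≤ 1) (hε0 : 0 < ε) (hε : ‖B * Q‖ ≤ ε) {t : ℝ}
    (ht : 0 < t) : ‖sqResolvent B t * B ^ 2 * Q‖ ≤ 2 * (ε ^ 2 / (t + ε ^ 2)) := by
  rcases le_total t (ε ^ 2) with h | h
  · have h1 : ‖sqResolvent B t * B ^ 2 * Q‖ ≤ 1 * 1 :=
      (norm_mul_le _ _).trans (by gcongr; exact norm_sqResolvent_mul_sq_le hB ht)
    refine h1.trans ?_
    rw [mul_div_assoc', le_div_iff₀ (by positivity)]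
    linarith
  · have h1 : ‖sqResolvent B t * B ^ 2 * Q‖ ≤ t⁻¹ * ε ^ 2 := by
      rw [mul_assoc]
      exact (norm_mul_le _ _).trans (by
        gcongr
        · exact norm_sqResolvent_le ht
        · exact norm_sq_mul_le hBQ hQ hε)
    refine h1.trans ?_
    rw [inv_mul_eq_div, mul_div_assoc', div_le_div_iff₀ ht (by positivity)]
    nlinarith [sq_nonneg ε]

theorem norm_sqResolvent_mul_mul_le (hε : ‖B * Q‖ ≤ ε) {t : ℝ} (ht : 0 < t) :
    ‖sqResolvent B t * (B * Q)‖ ≤ t⁻¹ * ε :=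
  (norm_mul_le _ _).trans (by gcongr; exact norm_sqResolvent_le ht)

/-- The compression by `Q` of the commutator of the resolvent of `B²`. -/
theorem norm_compression_lie_sqResolvent_le (hB : IsSelfAdjoint B) (hBQ : Commute B Q)
    (hQ : IsIdempotentElem Q) (hQ1 : ‖Q‖ ≤ 1) (hε0 : 0 < ε) (hε : ‖B * Q‖ ≤ ε)
    (hE : Q * ⁅B ^ 2, a⁆ * Q = -(B ^ 2 * Q * E * (B * Q) + B * Q * E * (B ^ 2 * Q)))
    {t : ℝ} (ht : 0 < t) :
    ‖Q * ⁅sqResolvent B t, a⁆ * Q‖ ≤ 4 * (ε ^ 2 / (t + ε ^ 2)) * (t⁻¹ * ε) * ‖E‖ := by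
  set R := sqResolvent B t with hR
  have hRQ : Commute R Q := commute_sqResolvent hBQ t
  have hRB : Commute R B := commute_sqResolvent rfl t
  -- The scalar `t` is central, so `t + B²` and `B²` have the same commutator with `a`.
  have h1 : ⁅R, a⁆ = -(R * ⁅B ^ 2, a⁆ * R) := by
    rw [lie_eq_of_mul_eq_one (sqResolvent_mul hB ht) (mul_sqResolvent hB ht)]
    simp only [Ring.lie_def, add_mul, mul_add, Algebra.commutes, add_sub_add_left_eq_sub, hR]
  have h2 : Q * ⁅R, a⁆ * Q =
      R * B ^ 2 * Q * E * (R * (B * Q)) + R * (B * Q) * E * (R * B ^ 2 * Q) := by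
    have e1 : Q * ⁅R, a⁆ * Q = -(R * (Q * ⁅B ^ 2, a⁆ * Q) * R) := by
      rw [h1]
      have := hRQ.eq
      calc Q * -(R * ⁅B ^ 2, a⁆ * R) * Q = -((Q * R) * ⁅B ^ 2, a⁆ * (R * Q)) := by noncomm_ring
        _ = _ := by rw [← this, this]; nth_rw 1 [← this]; noncomm_ring
    have hc1 : B * Q * R = R * (B * Q) := (hRB.mul_right hRQ).eq.symm
    have hc2 : B ^ 2 * Q * R = R * (B ^ 2 * Q) := ((hRB.pow_right 2).mul_right hRQ).eq.symm
    rw [e1, hE]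
    calc -(R * -(B ^ 2 * Q * E * (B * Q) + B * Q * E * (B ^ 2 * Q)) * R)
        = R * (B ^ 2 * Q) * E * (B * Q * R) + R * (B * Q) * E * (B ^ 2 * Q * R) := by noncomm_ring
      _ = _ := by rw [hc1, hc2, mul_assoc R (B ^ 2) Q]
  have n1 := norm_sqResolvent_mul_sq_mul_le hB hBQ hQ hQ1 hε0 hε ht
  have n2 := norm_sqResolvent_mul_mul_le hε ht (B := B)
  rw [← hR] at n1 n2
  have m1 : ‖R * B ^ 2 * Q * E * (R * (B * Q))‖ ≤
      2 * (ε ^ 2 / (t + ε ^ 2)) * ‖E‖ * (t⁻¹ * ε) :=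
    (norm_mul_le _ _).trans (mul_le_mul ((norm_mul_le _ _).trans (by gcongr)) n2
      (norm_nonneg _) (by positivity))
  have m2 : ‖R * (B * Q) * E * (R * B ^ 2 * Q)‖ ≤
      (t⁻¹ * ε) * ‖E‖ * (2 * (ε ^ 2 / (t + ε ^ 2))) :=
    (norm_mul_le _ _).trans (mul_le_mul ((norm_mul_le _ _).trans (by gcongr)) n1
      (norm_nonneg _) (by positivity))
  rw [h2]
  refine (norm_add_le _ _).trans ((add_le_add m1 m2).trans (le_of_eq (by ring)))

/-! ### Integral representation of powers and the resulting estimates -/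

/-- The integrand representing `|B|^{2α}`, `0 < α < 1`. -/
def absPowIntegrand (α : ℝ) (B : A) (t : ℝ) : A :=
  cfc (fun x : ℝ => Real.rpowIntegrand₀₁ α t (x ^ 2)) B

theorem absPowIntegrand_eq_sub (hB : IsSelfAdjoint B) {α t : ℝ} (ht : 0 < t) :
    absPowIntegrand α B t = algebraMap ℝ A (t ^ α * t⁻¹) - t ^ α • sqResolvent B t := by
  have hc : Continuous fun x : ℝ => (t + x ^ 2)⁻¹ :=
    (by fun_prop : Continuous fun x : ℝ => t + x ^ 2).inv₀ fun x => by positivity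
  have h := cfc_sub (fun _ : ℝ => t ^ α * t⁻¹) (fun x : ℝ => t ^ α * (t + x ^ 2)⁻¹) B
    continuousOn_const (continuous_const.mul hc).continuousOn
  rw [cfc_const .., cfc_const_mul _ _ _ hc.continuousOn] at h
  rw [sqResolvent, ← h, absPowIntegrand]
  simp only [Real.rpowIntegrand₀₁, mul_sub]

/-- The factor `B²` shown here makes the product with `Q` small; the difference form
`absPowIntegrand_eq_sub` is the one suited to commutators. -/
theorem absPowIntegrand_eq_mul (hB : IsSelfAdjoint B) {α t : ℝ} (ht : 0 < t) :
    absPowIntegrand α B t = (t ^ α * t⁻¹) • (sqResolvent B t * B ^ 2) := by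
  have h := sqResolvent_mul hB ht
  rw [mul_add, ← Algebra.commutes, ← Algebra.smul_def, ← eq_sub_iff_add_eq'] at h
  rw [h, absPowIntegrand_eq_sub hB ht, smul_sub, smul_smul, Algebra.algebraMap_eq_smul_one,
    inv_mul_cancel_right₀ ht.ne']

theorem norm_absPowIntegrand_mul_le (hB : IsSelfAdjoint B) (hBQ : Commute B Q)
    (hQ : IsIdempotentElem Q) (hQ1 : ‖Q‖ ≤ 1) (hε0 : 0 < ε) (hε : ‖B * Q‖ ≤ ε) {α t : ℝ}
    (ht : 0 < t) :
    ‖absPowIntegrand α B t * Q‖ ≤ 2 * Real.rpowIntegrand₀₁ α t (ε ^ 2) := by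
  rw [absPowIntegrand_eq_mul hB ht, smul_mul_assoc, norm_smul, Real.norm_of_nonneg (by positivity)]
  refine (mul_le_mul_of_nonneg_left
    (norm_sqResolvent_mul_sq_mul_le hB hBQ hQ hQ1 hε0 hε ht) (by positivity)).trans (le_of_eq ?_)
  rw [Real.rpowIntegrand₀₁]
  field_simp
  ring

/-- The scalar part of the integrand drops out of the commutator, and `t^α` times the resolvent
estimate is a multiple of the scalar integrand at `ε²`. -/
theorem norm_compression_lie_absPowIntegrand_le (hB : IsSelfAdjoint B) (hBQ : Commute B Q)
    (hQ : IsIdempotentElem Q) (hQ1 : ‖Q‖ ≤ 1) (hε0 : 0 < ε) (hε : ‖B * Q‖ ≤ ε)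
    (hE : Q * ⁅B ^ 2, a⁆ * Q = -(B ^ 2 * Q * E * (B * Q) + B * Q * E * (B ^ 2 * Q)))
    {α t : ℝ} (ht : 0 < t) :
    ‖Q * ⁅absPowIntegrand α B t, a⁆ * Q‖ ≤
      4 * ε * ‖E‖ * Real.rpowIntegrand₀₁ α t (ε ^ 2) := by
  have h : Q * ⁅absPowIntegrand α B t, a⁆ * Q = -(t ^ α • (Q * ⁅sqResolvent B t, a⁆ * Q)) := by
    have h0 : ∀ c y : A, c * a = a * c → (c - y) * a - a * (c - y) = -(y * a - a * y) := by
      intro c y h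
      rw [sub_mul, mul_sub, h]
      abel
    rw [absPowIntegrand_eq_sub hB ht, Ring.lie_def, h0 _ _ (Algebra.commutes _ _)]
    simp only [Ring.lie_def, mul_neg, neg_mul, smul_mul_assoc, mul_smul_comm, ← smul_sub]
  rw [h, norm_neg, norm_smul, Real.norm_of_nonneg (by positivity)]
  refine (mul_le_mul_of_nonneg_left
    (norm_compression_lie_sqResolvent_le hB hBQ hQ hQ1 hε0 hε hE ht)
    (by positivity)).trans (le_of_eq ?_)
  rw [Real.rpowIntegrand₀₁]
  field_simp
  ring

/-- The scalar formula at `x²` passes through the functional calculus, dominated by its value at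
`‖B‖²` by monotonicity. A single measure serves scalars and operators, so operator bounds integrate
to scalar powers. -/
theorem exists_measure_absPow_eq_integral {α : ℝ} (hα : α ∈ Ioo (0 : ℝ) 1) :
    ∃ μ : Measure ℝ, (∀ x ∈ Ici (0 : ℝ),
      IntegrableOn (fun t => Real.rpowIntegrand₀₁ α t x) (Ioi 0) μ ∧
        x ^ α = ∫ t in Ioi 0, Real.rpowIntegrand₀₁ α t x ∂μ) ∧
      ∀ B : A, IsSelfAdjoint B → IntegrableOn (fun t => absPowIntegrand α B t) (Ioi 0) μ ∧
        cfc (fun x : ℝ => |x| ^ (2 * α)) B = ∫ t in Ioi 0, absPowIntegrand α B t ∂μ := by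
  obtain ⟨μ, hμ⟩ := Real.exists_measure_rpow_eq_integral_rpowIntegrand₀₁ hα
  refine ⟨μ, hμ, fun B hB => ?_⟩
  let bound (t : ℝ) := Real.rpowIntegrand₀₁ α t (‖B‖ ^ 2)
  have hf : ContinuousOn (Function.uncurry fun t x : ℝ => Real.rpowIntegrand₀₁ α t (x ^ 2))
      (Ioi (0 : ℝ) ×ˢ spectrum ℝ B) := by
    have h := Real.continuousOn_rpowIntegrand₀₁_uncurry hα (Ici 0) subset_rfl
    exact h.comp (f := fun z : ℝ × ℝ => (z.1, z.2 ^ 2)) (by fun_prop)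
      fun z hz => ⟨hz.1, sq_nonneg z.2⟩
  have hbound : ∀ᵐ t ∂μ.restrict (Ioi 0), ∀ z ∈ spectrum ℝ B,
      ‖Real.rpowIntegrand₀₁ α t (z ^ 2)‖ ≤ bound t := by
    filter_upwards [ae_restrict_mem measurableSet_Ioi] with t ht z hz
    rw [Real.norm_of_nonneg (Real.rpowIntegrand₀₁_nonneg hα.1 ht.le (sq_nonneg z))]
    refine Real.rpowIntegrand₀₁_monotoneOn hα ht.le (sq_nonneg z) (sq_nonneg ‖B‖) ?_
    have : ‖z‖ ≤ ‖B‖ * ‖(1 : A)‖ := spectrum.norm_le_norm_mul_of_mem hz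
    have h1 : ‖(1 : A)‖ ≤ 1 := by
      rcases subsingleton_or_nontrivial A with h | h
      · simp [Subsingleton.elim (1 : A) 0]
      · exact CStarRing.norm_one.le
    rw [← sq_abs z, ← Real.norm_eq_abs]
    gcongr
    nlinarith [norm_nonneg B]
  have hfin : HasFiniteIntegral bound (μ.restrict (Ioi 0)) := (hμ _ (sq_nonneg ‖B‖)).1.2
  refine ⟨integrableOn_cfc measurableSet_Ioi _ bound B hf hbound hfin, ?_⟩
  refine Eq.trans (cfc_congr fun x _ => ?_)
    (cfc_setIntegral measurableSet_Ioi _ bound B hf hbound hfin)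
  rw [← (hμ (x ^ 2) (sq_nonneg x)).2, Real.rpow_mul (abs_nonneg x)]
  norm_num

theorem norm_absPow_mul_le (hB : IsSelfAdjoint B) (hBQ : Commute B Q)
    (hQ : IsIdempotentElem Q) (hQ1 : ‖Q‖ ≤ 1) (hε0 : 0 < ε) (hε : ‖B * Q‖ ≤ ε) {r : ℝ}
    (hr : r ∈ Ioo (0 : ℝ) 2) :
    ‖cfc (fun x : ℝ => |x| ^ r) B * Q‖ ≤ 2 * ε ^ r := by
  obtain ⟨μ, hμ, hμ'⟩ := exists_measure_absPow_eq_integral (A := A) (α := r / 2)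
    ⟨by linarith [hr.1], by linarith [hr.2]⟩
  obtain ⟨hi, he⟩ := hμ' B hB
  obtain ⟨hi2, he2⟩ := hμ (ε ^ 2) (sq_nonneg ε)
  rw [mul_div_cancel₀ r two_ne_zero] at he
  have h : (∫ t in Ioi 0, absPowIntegrand (r / 2) B t ∂μ) * Q =
      ∫ t in Ioi 0, absPowIntegrand (r / 2) B t * Q ∂μ :=
    (((ContinuousLinearMap.mul ℝ A).flip Q).integral_comp_comm hi).symm
  rw [he, h]
  refine (norm_integral_le_of_norm_le (hi2.const_mul 2) ?_).trans (le_of_eq ?_)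
  · filter_upwards [ae_restrict_mem measurableSet_Ioi] with t ht
    exact norm_absPowIntegrand_mul_le hB hBQ hQ hQ1 hε0 hε ht
  · rw [integral_const_mul, ← he2, ← Real.rpow_natCast, ← Real.rpow_mul hε0.le]
    norm_num [mul_div_cancel₀]

/-- The integral formula needs `α = r / 2 < 1`, hence the range of `r`. Integrating the pointwise
bound turns the scalar integrand at `ε²` into `ε^r`. -/
theorem norm_compression_lie_absPow_le_of_lt_two (hB : IsSelfAdjoint B) (hBQ : Commute B Q)
    (hQ : IsIdempotentElem Q) (hQ1 : ‖Q‖ ≤ 1) (hε0 : 0 < ε) (hε : ‖B * Q‖ ≤ ε)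
    (hE : Q * ⁅B ^ 2, a⁆ * Q = -(B ^ 2 * Q * E * (B * Q) + B * Q * E * (B ^ 2 * Q))) {r : ℝ}
    (hr : r ∈ Ioo (0 : ℝ) 2) :
    ‖Q * ⁅cfc (fun x : ℝ => |x| ^ r) B, a⁆ * Q‖ ≤ 4 * ε ^ (r + 1) * ‖E‖ := by
  obtain ⟨μ, hμ, hμ'⟩ := exists_measure_absPow_eq_integral (A := A) (α := r / 2)
    ⟨by linarith [hr.1], by linarith [hr.2]⟩
  obtain ⟨hi, he⟩ := hμ' B hB
  obtain ⟨hi2, he2⟩ := hμ (ε ^ 2) (sq_nonneg ε)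
  rw [mul_div_cancel₀ r two_ne_zero] at he
  let M := ContinuousLinearMap.mul ℝ A
  let L : A →L[ℝ] A := (M Q).comp ((M.flip Q).comp (M.flip a - M a))
  have hL : ∀ x : A, Q * ⁅x, a⁆ * Q = L x := fun x => by
    rw [Ring.lie_def, mul_assoc]
    rfl
  rw [he, hL, ← L.integral_comp_comm hi]
  refine (norm_integral_le_of_norm_le (hi2.const_mul (4 * ε * ‖E‖)) ?_).trans (le_of_eq ?_)
  · filter_upwards [ae_restrict_mem measurableSet_Ioi] with t ht
    rw [← hL]
    exact norm_compression_lie_absPowIntegrand_le hB hBQ hQ hQ1 hε0 hε hE ht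
  · rw [integral_const_mul, ← he2, ← Real.rpow_natCast, ← Real.rpow_mul hε0.le,
      Real.rpow_add_one hε0.ne']
    norm_num [mul_div_cancel₀]
    ring

/-- Leibniz estimate for the compressed commutator of a power. -/
theorem norm_compression_lie_pow_le {G : A} (hG : Commute G Q) (hQ : IsIdempotentElem Q)
    {c k : ℝ} (hc : ‖G * Q‖ ≤ c) (hk : ‖Q * ⁅G, a⁆ * Q‖ ≤ k) (n : ℕ) :
    ‖Q * ⁅G ^ (n + 1), a⁆ * Q‖ ≤ (n + 1) * c ^ n * k := by
  have hc0 : 0 ≤ c := (norm_nonneg _).trans hc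
  have hk0 : 0 ≤ k := (norm_nonneg _).trans hk
  have hpow : ∀ n : ℕ, ‖G ^ (n + 1) * Q‖ ≤ c ^ (n + 1) := by
    intro n
    have : G ^ (n + 1) * Q = (G * Q) ^ (n + 1) := by rw [hG.mul_pow, hQ.pow_succ_eq]
    rw [this]
    exact (norm_pow_le' _ n.succ_pos).trans (by gcongr)
  induction n with
  | zero => simpa using hk
  | succ n ih =>
    -- Leibniz rule; since `Q` is idempotent and commutes with `G`, a copy of it can be inserted
    -- between the factors of each term.
    have e : Q * ⁅G ^ (n + 1 + 1), a⁆ * Q =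
        (Q * ⁅G ^ (n + 1), a⁆ * Q) * (G * Q) + (G ^ (n + 1) * Q) * (Q * ⁅G, a⁆ * Q) := by
      have h1 : Q * (G * Q) = G * Q := by rw [← mul_assoc, ← hG.eq, mul_assoc, hQ.eq]
      have h2 : G ^ (n + 1) * Q * Q = Q * G ^ (n + 1) := by
        rw [mul_assoc, hQ.eq, (hG.pow_left _).eq]
      calc _ = Q * ⁅G ^ (n + 1), a⁆ * (G * Q) + Q * G ^ (n + 1) * ⁅G, a⁆ * Q := by
            rw [pow_succ G (n + 1)]
            simp only [Ring.lie_def]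
            noncomm_ring
        _ = Q * ⁅G ^ (n + 1), a⁆ * (Q * (G * Q)) + (G ^ (n + 1) * Q * Q) * ⁅G, a⁆ * Q := by
            rw [h1, h2]
        _ = _ := by noncomm_ring
    rw [e]
    refine (norm_add_le _ _).trans
      ((add_le_add ((norm_mul_le _ _).trans (mul_le_mul ih hc (norm_nonneg _) (by positivity)))
        ((norm_mul_le _ _).trans (mul_le_mul (hpow n) hk (norm_nonneg _) (by positivity)))).trans
        (le_of_eq ?_))
    push_cast
    ring

/-- Writing `|B|^r = (|B|^s)^(n+1)` with small `s` reduces to exponents below 2. The constant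
precedes the algebra and all its elements, which yields the uniformity in the representation. -/
theorem exists_norm_compression_lie_absPow_le {r : ℝ} (hr : 0 < r) :
    ∃ C : ℝ, 0 < C ∧ ∀ (A : Type*) [CStarAlgebra A] (B Q a E : A) (ε : ℝ), IsSelfAdjoint B →
      Commute B Q → IsIdempotentElem Q → ‖Q‖ ≤ 1 → 0 < ε → ‖B * Q‖ ≤ ε →
      Q * ⁅B ^ 2, a⁆ * Q = -(B ^ 2 * Q * E * (B * Q) + B * Q * E * (B ^ 2 * Q)) →
      ‖Q * ⁅cfc (fun x : ℝ => |x| ^ r) B, a⁆ * Q‖ ≤ C * ε ^ (r + 1) * ‖E‖ := by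
  obtain ⟨n, hn⟩ := exists_nat_gt r
  have hn' : (0 : ℝ) < n + 1 := by positivity
  refine ⟨(n + 1) * 2 ^ n * 4, by positivity, fun A _ B Q a E ε hB hBQ hQ hQ1 hε0 hε hE => ?_⟩
  set s : ℝ := r / (n + 1) with hs
  have hs0 : 0 < s := by positivity
  have hs2 : s ∈ Ioo (0 : ℝ) 2 := ⟨hs0, by rw [hs, div_lt_iff₀ hn']; linarith⟩
  have hsr : s * (n + 1) = r := div_mul_cancel₀ _ hn'.ne'
  have hG : cfc (fun x : ℝ => |x| ^ r) B = cfc (fun x : ℝ => |x| ^ s) B ^ (n + 1) := by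
    rw [← cfc_pow _ _ _ (continuous_abs.rpow_const fun _ => Or.inr hs0.le).continuousOn]
    refine cfc_congr fun x _ => ?_
    rw [← Real.rpow_natCast, ← Real.rpow_mul (abs_nonneg x)]
    push_cast
    rw [hsr]
  rw [hG]
  refine (norm_compression_lie_pow_le (Commute.cfc_real hBQ _) hQ
    (norm_absPow_mul_le hB hBQ hQ hQ1 hε0 hε hs2)
    (norm_compression_lie_absPow_le_of_lt_two hB hBQ hQ hQ1 hε0 hε hE hs2) n).trans (le_of_eq ?_)
  have : ε ^ (r + 1) = (ε ^ s) ^ n * ε ^ (s + 1) := by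
    rw [← Real.rpow_natCast, ← Real.rpow_mul hε0.le, ← Real.rpow_add hε0, ← hsr]
    ring_nf
  rw [this, mul_pow]
  ring

end CStar

/-! ### The partial inverse, the kernel projection and the commutator with `D` -/

section KernelProjection

variable {H : Type*} [NormedAddCommGroup H] [InnerProductSpace ℂ H] [CompleteSpace H]
  {D : H →ₗ.[ℂ] H}

theorem map_mem_orthogonal_kernel (hD : IsSelfAdjoint D) (x : D.domain) :
    D x ∈ (kernel D)ᗮ := by
  rw [Submodule.mem_orthogonal]
  exact fun k hk => inner_kernel_map hD hk x

variable [(kernel D).HasOrthogonalProjection]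

/-- `D⁻¹ D = 1 - P₀` on the domain, `P₀` being the projection on the kernel. -/
theorem partialInverse_map_eq_sub (hD : IsSelfAdjoint D) (hR : HasCompactResolvent D)
    (x : D.domain) :
    partialInverse D (D x) = (x : H) - (kernel D).starProjection (x : H) := by
  obtain ⟨hkd, hk0⟩ := mem_kernel.1
    (Submodule.starProjection_apply_mem (kernel D) (x : H))
  have h := partialInverse_map hD hR (D.domain.sub_mem x.2 hkd)
    (Submodule.sub_starProjection_mem_orthogonal (K := kernel D) (x : H))
  have h1 : D (x - ⟨_, hkd⟩) = D x := by rw [LinearPMap.map_sub, hk0, sub_zero]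
  rw [← h1]
  exact h

/-- `D⁻¹` maps into the domain and `D D⁻¹ = 1 - P₀`. -/
theorem map_partialInverse (hD : IsSelfAdjoint D) (hR : HasCompactResolvent D) (y : H) :
    ∃ h : partialInverse D y ∈ D.domain,
      D ⟨partialInverse D y, h⟩ = y - (kernel D).starProjection y := by
  -- The graph of `D` is closed, so it is enough to check vectors `k + D u`, which are dense.
  have hcl : IsClosed {y : H | (partialInverse D y, y - (kernel D).starProjection y) ∈ D.graph} :=
    IsClosed.preimage (f := fun y : H => (partialInverse D y, y - (kernel D).starProjection y))
      (by fun_prop) hD.isClosed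
  have h : (partialInverse D y, y - (kernel D).starProjection y) ∈ D.graph := by
    refine (denseRange_coreSum hD).induction_on (p := fun y =>
      (partialInverse D y, y - (kernel D).starProjection y) ∈ D.graph) y hcl fun s => ?_
    rw [partialInverse_coreSum hD hR]
    have e : coreSum D s = (s.1 : H) + D ⟨s.2, s.2.2.1⟩ := by
      simp [coreSum]; rfl
    have e1 : (kernel D).starProjection (s.1 : H) = s.1 :=
      Submodule.starProjection_eq_self_iff.2 s.1.2
    have e2 : (kernel D).starProjection (D ⟨s.2, s.2.2.1⟩) = 0 :=
      (Submodule.starProjection_apply_eq_zero_iff _).2 (map_mem_orthogonal_kernel hD _)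
    rw [e, map_add, e1, e2, add_zero, add_sub_cancel_left]
    exact D.mem_graph ⟨s.2, s.2.2.1⟩
  obtain ⟨x, hx1, hx2⟩ := (LinearPMap.mem_graph_iff D).1 h
  simp only at hx1 hx2
  exact ⟨hx1 ▸ x.2, by rw [← hx2]; congr 1; exact Subtype.ext hx1.symm⟩

theorem partialInverse_mul_kernelProjection (hD : IsSelfAdjoint D) (hR : HasCompactResolvent D) :
    partialInverse D * (kernel D).starProjection = 0 := by
  ext y
  exact partialInverse_kernel hD hR (Submodule.starProjection_apply_mem _ _)

theorem kernelProjection_mul_partialInverse (hD : IsSelfAdjoint D) (hR : HasCompactResolvent D) :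
    (kernel D).starProjection * partialInverse D = 0 := by
  have h := congrArg star (partialInverse_mul_kernelProjection hD hR)
  rwa [star_mul, (isSelfAdjoint_partialInverse hD hR).star_eq,
    (isSelfAdjoint_starProjection (kernel D)).star_eq, star_zero] at h

variable {A : Type*} [Ring A] [StarRing A] [Algebra ℂ A] [StarModule ℂ A]
  {π : A →⋆ₐ[ℂ] (H →L[ℂ] H)}

theorem boundedCommutator_partialInverse_apply (h : IsSpectralTriple π D) (a : A) (y : H) :
    boundedCommutator D (π a) (partialInverse D y) =
      D ⟨π a (partialInverse D y), h.mapsTo_domain a _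
        (map_partialInverse h.isSelfAdjoint h.hasCompactResolvent y).1⟩ -
        π a (y - (kernel D).starProjection y) := by
  obtain ⟨hy, hy'⟩ := map_partialInverse h.isSelfAdjoint h.hasCompactResolvent y
  rw [boundedCommutator_apply h a ⟨_, hy⟩, hy']

/-- Expand `B (D a - a D) B` with `B D = 1 - P` and `D B = 1 - P`; the last two terms are the price
of `D` not being invertible. -/
theorem lie_partialInverse (h : IsSpectralTriple π D) (a : A) :
    ⁅partialInverse D, π a⁆ =
      -(partialInverse D * boundedCommutator D (π a) * partialInverse D) -
        (kernel D).starProjection * π a * partialInverse D +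
        partialInverse D * π a * (kernel D).starProjection := by
  ext y
  rw [Ring.lie_def]
  change partialInverse D (π a y) - π a (partialInverse D y) =
    -(partialInverse D (boundedCommutator D (π a) (partialInverse D y))) -
      (kernel D).starProjection (π a (partialInverse D y)) +
      partialInverse D (π a ((kernel D).starProjection y))
  rw [boundedCommutator_partialInverse_apply h, map_sub,
    partialInverse_map_eq_sub h.isSelfAdjoint h.hasCompactResolvent, map_sub, map_sub]
  abel

/-- Since `D P = 0`, `E P = D a P`, and `B D = 1 - P`. This block of `a` is thus bounded through `E`
rather than `‖a‖`. -/
theorem one_sub_kernelProjection_mul (h : IsSpectralTriple π D) (a : A) :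
    (1 - (kernel D).starProjection) * π a * (kernel D).starProjection =
      partialInverse D * boundedCommutator D (π a) * (kernel D).starProjection := by
  ext y
  change π a ((kernel D).starProjection y) -
    (kernel D).starProjection (π a ((kernel D).starProjection y)) =
    partialInverse D (boundedCommutator D (π a) ((kernel D).starProjection y))
  obtain ⟨hkd, hk0⟩ := mem_kernel.1 (Submodule.starProjection_apply_mem (kernel D) y)
  rw [boundedCommutator_apply h a ⟨_, hkd⟩, hk0, map_zero, sub_zero,
    partialInverse_map_eq_sub h.isSelfAdjoint h.hasCompactResolvent]

/-- The range of `D` is orthogonal to its kernel, so `P D a B = 0` and only `-P a D B` survives in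
`P E B`. -/
theorem kernelProjection_mul_one_sub (h : IsSpectralTriple π D) (a : A) :
    (kernel D).starProjection * π a * (1 - (kernel D).starProjection) =
      -((kernel D).starProjection * boundedCommutator D (π a) * partialInverse D) := by
  ext y
  change (kernel D).starProjection (π a (y - (kernel D).starProjection y)) =
    -((kernel D).starProjection (boundedCommutator D (π a) (partialInverse D y)))
  have hz := fun x => (Submodule.starProjection_apply_eq_zero_iff _).2
    (map_mem_orthogonal_kernel h.isSelfAdjoint x)
  rw [boundedCommutator_partialInverse_apply h]
  simp only [map_sub, hz]
  abel

theorem absNegPow_mul_kernelProjection (hD : IsSelfAdjoint D) (hR : HasCompactResolvent D) {q : ℝ}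
    (hq : 0 < q) : absNegPow D q * (kernel D).starProjection = 0 := by
  ext y
  obtain ⟨hkd, hk0⟩ := mem_kernel.1 (Submodule.starProjection_apply_mem (kernel D) y)
  simpa using absNegPow_eigenvector hD hR hq ⟨_, hkd⟩ 0 (by simpa using hk0)

theorem kernelProjection_mul_absNegPow (hD : IsSelfAdjoint D) (hR : HasCompactResolvent D) {q : ℝ}
    (hq : 0 < q) : (kernel D).starProjection * absNegPow D q = 0 := by
  have hc : Commute (partialInverse D) (kernel D).starProjection := by
    rw [commute_iff_eq, partialInverse_mul_kernelProjection hD hR,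
      kernelProjection_mul_partialInverse hD hR]
  have hc' : Commute (absNegPow D q) (kernel D).starProjection := hc.cfc_real _
  rw [← hc'.eq, absNegPow_mul_kernelProjection hD hR hq]

/-- The compression of `[D⁻², a]` by a projection orthogonal to the kernel. -/
theorem compression_lie_partialInverse_sq (h : IsSpectralTriple π D) (a : A) {Q : H →L[ℂ] H}
    (hBQ : Commute (partialInverse D) Q) (hQ₁ : Q * (kernel D).starProjection = 0)
    (hQ₂ : (kernel D).starProjection * Q = 0) :
    Q * ⁅partialInverse D ^ 2, π a⁆ * Q =
      -(partialInverse D ^ 2 * Q * boundedCommutator D (π a) * (partialInverse D * Q) +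
        partialInverse D * Q * boundedCommutator D (π a) * (partialInverse D ^ 2 * Q)) := by
  have hX := lie_partialInverse h a
  have hB₁ := partialInverse_mul_kernelProjection h.isSelfAdjoint h.hasCompactResolvent
  have hB₂ := kernelProjection_mul_partialInverse h.isSelfAdjoint h.hasCompactResolvent
  set B := partialInverse D
  set P := (kernel D).starProjection
  set E := boundedCommutator D (π a)
  have h1 : ⁅B ^ 2, π a⁆ = B * ⁅B, π a⁆ + ⁅B, π a⁆ * B := by
    simp only [Ring.lie_def]; noncomm_ring
  -- Each kernel correction contains one of `B P`, `P B`, `Q P`, `P Q`, all of which vanish.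
  calc Q * ⁅B ^ 2, π a⁆ * Q
      = -((Q * B ^ 2) * E * (B * Q) + (Q * B) * E * (B ^ 2 * Q))
        - Q * (B * P) * π a * B * Q + Q * B ^ 2 * π a * (P * Q)
        - (Q * P) * π a * B ^ 2 * Q + Q * B * π a * (P * B) * Q := by
        rw [h1, hX]; noncomm_ring
    _ = _ := by
        rw [hB₁, hB₂, hQ₁, hQ₂, ← hBQ.eq, ← (hBQ.pow_left 2).eq]
        simp

/-- The norm of `[|D|^{-q}, a]` is controlled by that of `[D, a]`. -/
theorem exists_norm_lie_absNegPow_le (hD : IsSelfAdjoint D) (hR : HasCompactResolvent D) {q : ℝ}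
    (hq : 0 < q) :
    ∃ C : ℝ, 0 < C ∧ ∀ (A : Type*) [Ring A] [StarRing A] [Algebra ℂ A] [StarModule ℂ A]
      (π : A →⋆ₐ[ℂ] (H →L[ℂ] H)), IsSpectralTriple π D → ∀ a : A,
        ‖⁅absNegPow D q, π a⁆‖ ≤ C * ‖boundedCommutator D (π a)‖ := by
  obtain ⟨C, hC, hbound⟩ := exists_norm_compression_lie_absPow_le hq
  have hG₁ := absNegPow_mul_kernelProjection hD hR hq
  have hG₂ := kernelProjection_mul_absNegPow hD hR hq
  have hB₁ := partialInverse_mul_kernelProjection hD hR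
  have hB₂ := kernelProjection_mul_partialInverse hD hR
  -- The compression estimate is used with `Q = 1 - P` and `ε = ‖B‖ + 1`; the summand `1` keeps `ε`
  -- positive when `B = 0`.
  refine ⟨C * (‖partialInverse D‖ + 1) ^ (q + 1) +
    2 * (‖partialInverse D‖ * ‖absNegPow D q‖), by positivity, fun A _ _ _ _ π h a => ?_⟩
  have hPi : IsIdempotentElem (kernel D).starProjection :=
    Submodule.isIdempotentElem_starProjection _
  have hP1 : ‖(kernel D).starProjection‖ ≤ 1 := Submodule.starProjection_norm_le _
  have hQ1 : ‖1 - (kernel D).starProjection‖ ≤ 1 := by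
    have : 1 - (kernel D).starProjection = (kernel D)ᗮ.starProjection :=
      (Submodule.starProjection_orthogonal' _).symm
    rw [this]
    exact Submodule.starProjection_norm_le _
  have hcomp := compression_lie_partialInverse_sq h a (Q := 1 - (kernel D).starProjection)
    (by rw [commute_iff_eq, mul_sub, sub_mul, hB₁, hB₂, mul_one, one_mul])
    (by rw [sub_mul, one_mul, hPi.eq, sub_self]) (by rw [mul_sub, mul_one, hPi.eq, sub_self])
  have h1 := one_sub_kernelProjection_mul h a
  have h2 := kernelProjection_mul_one_sub h a
  have hb := hbound (H →L[ℂ] H) (partialInverse D) (1 - (kernel D).starProjection) (π a)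
    (boundedCommutator D (π a)) (‖partialInverse D‖ + 1) (isSelfAdjoint_partialInverse hD hR)
    (by rw [commute_iff_eq, mul_sub, sub_mul, hB₁, hB₂, mul_one, one_mul]) hPi.one_sub hQ1
    (by positivity) (by rw [mul_sub, hB₁, mul_one, sub_zero]; linarith) hcomp
  change ‖_ * ⁅absNegPow D q, π a⁆ * _‖ ≤ _ at hb
  set B := partialInverse D
  set P := (kernel D).starProjection
  set E := boundedCommutator D (π a)
  set G := absNegPow D q
  -- Block decomposition along `ker D`: as `G P = P G = 0`, the corner at `P` vanishes and the
  -- off-diagonal blocks are `-P a G` and `G a P`.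
  have e : ⁅G, π a⁆ = (1 - P) * ⁅G, π a⁆ * (1 - P) + P * E * (B * G) + G * B * E * P := by
    have e1 : P * E * (B * G) = -(P * π a * G) := by
      have : P * π a * G = P * π a * (1 - P) * G := by
        rw [mul_assoc _ (1 - P) G, sub_mul, hG₂, one_mul, sub_zero]
      rw [this, h2]; noncomm_ring
    have e2 : G * B * E * P = G * π a * P := by
      have : G * π a * P = G * ((1 - P) * π a * P) := by
        rw [mul_assoc (1 - P), ← mul_assoc G (1 - P), mul_sub, hG₁, mul_one, sub_zero, mul_assoc]
      rw [this, h1]; noncomm_ring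
    have e3 : (1 - P) * ⁅G, π a⁆ * (1 - P) = G * π a - π a * G - G * π a * P + P * π a * G
        - (P * G) * π a * (1 - P) + (1 - P) * π a * (G * P) := by
      rw [Ring.lie_def]; noncomm_ring
    rw [e1, e2, e3, hG₁, hG₂, Ring.lie_def]
    simp
  rw [e]
  have n1 : ‖P * E * (B * G)‖ ≤ 1 * ‖E‖ * (‖B‖ * ‖G‖) :=
    (norm_mul_le _ _).trans (mul_le_mul ((norm_mul_le _ _).trans (by gcongr))
      (norm_mul_le _ _) (norm_nonneg _) (by positivity))
  have n2 : ‖G * B * E * P‖ ≤ ‖G‖ * ‖B‖ * ‖E‖ * 1 :=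
    (norm_mul_le _ _).trans (mul_le_mul ((norm_mul_le _ _).trans
      (by gcongr; exact norm_mul_le _ _)) hP1 (norm_nonneg _) (by positivity))
  refine (norm_add₃_le).trans ((add_le_add (add_le_add hb n1) n2).trans (le_of_eq (by ring)))

end KernelProjection

/-! ### Singular values, spectral subspaces and compressions -/

section SingularValues

variable {H : Type*} [NormedAddCommGroup H] [InnerProductSpace ℂ H]

theorem bddBelow_singularValue (T : H →L[ℂ] H) (j : ℕ) :
    BddBelow (range fun R : {R : H →L[ℂ] H // LinearMap.rank (R : H →ₗ[ℂ] H) ≤ (j : Cardinal)} =>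
      ‖T - R.1‖) :=
  ⟨0, by rintro _ ⟨R, rfl⟩; exact norm_nonneg _⟩

theorem nonempty_rank_le (j : ℕ) :
    Nonempty {R : H →L[ℂ] H // LinearMap.rank (R : H →ₗ[ℂ] H) ≤ (j : Cardinal)} :=
  ⟨⟨0, by simp [LinearMap.rank_zero]⟩⟩

theorem singularValue_nonneg (T : H →L[ℂ] H) (j : ℕ) : 0 ≤ singularValue T j :=
  Real.iInf_nonneg fun _ => norm_nonneg _

theorem singularValue_le {T R : H →L[ℂ] H} {j : ℕ}
    (hR : LinearMap.rank (R : H →ₗ[ℂ] H) ≤ (j : Cardinal)) : singularValue T j ≤ ‖T - R‖ :=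
  ciInf_le (bddBelow_singularValue T j) ⟨R, hR⟩

theorem singularValue_le_norm (T : H →L[ℂ] H) (j : ℕ) : singularValue T j ≤ ‖T‖ := by
  simpa using singularValue_le (T := T) (R := 0) (j := j) (by simp [LinearMap.rank_zero])

theorem exists_norm_sub_lt_of_singularValue_lt {T : H →L[ℂ] H} {j : ℕ} {ε : ℝ}
    (h : singularValue T j < ε) :
    ∃ R : H →L[ℂ] H, LinearMap.rank (R : H →ₗ[ℂ] H) ≤ (j : Cardinal) ∧ ‖T - R‖ < ε := by
  have := nonempty_rank_le (H := H) j
  obtain ⟨R, hR⟩ := exists_lt_of_ciInf_lt h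
  exact ⟨R.1, R.2, hR⟩

/-- A bounded operator of finite rank is compact. -/
theorem isCompactOperator_of_rank_le {R : H →L[ℂ] H} {j : ℕ}
    (hR : LinearMap.rank (R : H →ₗ[ℂ] H) ≤ (j : Cardinal)) : IsCompactOperator R := by
  have hfin : FiniteDimensional ℂ (LinearMap.range (R : H →ₗ[ℂ] H)) :=
    Module.rank_lt_aleph0_iff.1 (hR.trans_lt (Cardinal.natCast_lt_aleph0))
  have : ProperSpace (LinearMap.range (R : H →ₗ[ℂ] H)) := FiniteDimensional.proper ℂ _
  exact (isCompactOperator_of_locallyCompactSpace_rng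
    (LinearMap.range (R : H →ₗ[ℂ] H)).subtypeL).comp_clm
    (R.codRestrict _ fun x => LinearMap.mem_range_self (R : H →ₗ[ℂ] H) x)

/-- An operator whose singular values tend to zero is compact. -/
theorem isCompactOperator_of_tendsto_singularValue [CompleteSpace H] {T : H →L[ℂ] H}
    (h : Filter.Tendsto (singularValue T) Filter.atTop (nhds 0)) : IsCompactOperator T := by
  have h1 : ∀ n : ℕ, ∃ R : H →L[ℂ] H, IsCompactOperator R ∧ ‖T - R‖ < 1 / ((n : ℝ) + 1) := by
    intro n
    obtain ⟨j, hj⟩ := (h.eventually_lt_const (Nat.one_div_pos_of_nat (n := n))).exists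
    obtain ⟨R, hR, hTR⟩ := exists_norm_sub_lt_of_singularValue_lt hj
    exact ⟨R, isCompactOperator_of_rank_le hR, hTR⟩
  choose R hR hTR using h1
  refine isCompactOperator_of_tendsto (F := R) (l := Filter.atTop) ?_ (.of_forall hR)
  rw [tendsto_iff_norm_sub_tendsto_zero]
  refine squeeze_zero (fun _ => norm_nonneg _) (fun n => ?_)
    tendsto_one_div_add_atTop_nhds_zero_nat
  rw [norm_sub_rev]
  exact (hTR n).le

/-- The sum of the eigenspaces of `T` for the eigenvalues of modulus larger than `ε`. -/
def largeEigenspace (T : H →L[ℂ] H) (ε : ℝ) : Submodule ℂ H :=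
  ⨆ μ : {μ : ℂ // ε < ‖μ‖}, Module.End.eigenspace (T : Module.End ℂ H) μ.1

theorem mem_largeEigenspace {T : H →L[ℂ] H} {ε : ℝ} {μ : ℂ} (hμ : ε < ‖μ‖) {x : H}
    (hx : T x = μ • x) : x ∈ largeEigenspace T ε :=
  Submodule.mem_iSup_of_mem (⟨μ, hμ⟩ : {μ : ℂ // ε < ‖μ‖}) (Module.End.mem_eigenspace_iff.2 hx)

theorem map_mem_largeEigenspace {T : H →L[ℂ] H} {ε : ℝ} {x : H} (hx : x ∈ largeEigenspace T ε) :
    T x ∈ largeEigenspace T ε := by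
  induction hx using Submodule.iSup_induction' with
  | mem i x hx =>
    have hx' : T x = i.1 • x := Module.End.mem_eigenspace_iff.1 hx
    rw [hx']
    exact Submodule.smul_mem _ _ (mem_largeEigenspace i.2 hx')
  | zero => simp
  | add x y _ _ hx hy =>
    rw [map_add]
    exact Submodule.add_mem _ hx hy

/-- Eigenspaces of a symmetric operator are orthogonal, so Pythagoras applies to both `x` and `T x`.
-/
theorem le_norm_map_of_mem_largeEigenspace {T : H →L[ℂ] H}
    (hT : (T : H →ₗ[ℂ] H).IsSymmetric) {ε : ℝ} (hε : 0 ≤ ε) {x : H}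
    (hx : x ∈ largeEigenspace T ε) : ε * ‖x‖ ≤ ‖T x‖ := by
  obtain ⟨f, hf, rfl⟩ := (Submodule.mem_iSup_iff_exists_finsupp _ _).1 hx
  have hV : OrthogonalFamily ℂ
      (fun μ : {μ : ℂ // ε < ‖μ‖} => Module.End.eigenspace (T : Module.End ℂ H) μ.1)
      fun μ => (Module.End.eigenspace (T : Module.End ℂ H) μ.1).subtypeₗᵢ :=
    hT.orthogonalFamily_eigenspaces.comp Subtype.coe_injective
  have h1 := hV.norm_sum (fun μ => ⟨f μ, hf μ⟩) f.support
  have h2 := hV.norm_sum (fun μ => μ.1 • ⟨f μ, hf μ⟩) f.support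
  have hTf : ∀ μ, T (f μ) = μ.1 • f μ := fun μ => Module.End.mem_eigenspace_iff.1 (hf μ)
  simp only [norm_smul, Submodule.coe_norm] at h1 h2
  change ‖∑ μ ∈ f.support, f μ‖ ^ 2 = _ at h1
  change ‖∑ μ ∈ f.support, μ.1 • f μ‖ ^ 2 = _ at h2
  refine abs_le_of_sq_le_sq' ?_ (norm_nonneg _) |>.2
  rw [Finsupp.sum, map_sum, mul_pow, h1]
  simp only [hTf]
  rw [h2, Finset.mul_sum]
  refine Finset.sum_le_sum fun μ _ => ?_
  rw [← mul_pow]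
  gcongr
  exact μ.2.le

/-- An `R` of rank at most `j` with `‖T - R‖ < ε` is injective on this space: `R x = 0` would give
`ε ‖x‖ ≤ ‖T x‖ = ‖(T - R) x‖`, forcing `x = 0`. -/
theorem rank_largeEigenspace_le {T : H →L[ℂ] H} (hT : (T : H →ₗ[ℂ] H).IsSymmetric) {ε : ℝ}
    {j : ℕ} (h : singularValue T j < ε) : Module.rank ℂ (largeEigenspace T ε) ≤ j := by
  have hε : 0 ≤ ε := (singularValue_nonneg T j).trans h.le
  obtain ⟨R, hR, hTR⟩ := exists_norm_sub_lt_of_singularValue_lt h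
  have hinj : Function.Injective
      ((R : H →ₗ[ℂ] H).rangeRestrict ∘ₗ (largeEigenspace T ε).subtype) := by
    rw [← LinearMap.ker_eq_bot, LinearMap.ker_eq_bot']
    intro x hx
    have hRx : R x = 0 := congrArg Subtype.val hx
    by_contra hx0
    have hpos : 0 < ‖(x : H)‖ := norm_pos_iff.2 fun h => hx0 (Subtype.ext h)
    have h1 := le_norm_map_of_mem_largeEigenspace hT hε x.2
    have h2 : ‖T x‖ ≤ ‖T - R‖ * ‖(x : H)‖ := by
      simpa [hRx] using (T - R).le_opNorm (x : H)
    exact absurd (h1.trans h2) (not_le.2 (mul_lt_mul_of_pos_right hTR hpos))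
  exact (LinearMap.rank_le_of_injective _ hinj).trans hR

theorem commute_starProjection_orthogonal [CompleteSpace H] {T : H →L[ℂ] H}
    (hT : (T : H →ₗ[ℂ] H).IsSymmetric)
    {U : Submodule ℂ H} [U.HasOrthogonalProjection] (hU : ∀ x ∈ U, T x ∈ U) :
    Commute T Uᗮ.starProjection := by
  have hU' : ∀ x ∈ Uᗮ, T x ∈ Uᗮ := fun x hx => by
    rw [Submodule.mem_orthogonal] at hx ⊢
    exact fun u hu => (hT u x).symm.trans (hx _ (hU u hu))
  ext x
  change T (Uᗮ.starProjection x) = Uᗮ.starProjection (T x)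
  refine Eq.symm <| Submodule.eq_starProjection_of_mem_orthogonal
    (hU' _ (Submodule.starProjection_apply_mem _ _)) ?_
  rw [← map_sub, Submodule.orthogonal_orthogonal]
  refine hU _ ?_
  rw [Submodule.starProjection_orthogonal_val, sub_sub_cancel]
  exact Submodule.starProjection_apply_mem _ _

/-- With `Q` the projection onto `Uᗮ`, `T Q` is compact and selfadjoint, so if its norm exceeded `ε`
it would have an eigenvalue of that modulus. Its eigenvector would lie in `Uᗮ` and also in the large
eigenspace, hence in `U`. -/
theorem norm_mul_starProjection_orthogonal_le [CompleteSpace H] {T : H →L[ℂ] H} (hT : IsSelfAdjoint T)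
    (hc : IsCompactOperator T) {U : Submodule ℂ H} [U.HasOrthogonalProjection]
    (hU : ∀ x ∈ U, T x ∈ U) {ε : ℝ} (hε : 0 ≤ ε) (hle : largeEigenspace T ε ≤ U) :
    ‖T * Uᗮ.starProjection‖ ≤ ε := by
  have hcomm := commute_starProjection_orthogonal
    (ContinuousLinearMap.isSelfAdjoint_iff_isSymmetric.1 hT) hU
  set Q := Uᗮ.starProjection with hQ
  by_contra! hlt
  have hsa : IsSelfAdjoint (T * Q) :=
    (hT.commute_iff (isSelfAdjoint_starProjection _)).1 hcomm
  have hne : T * Q ≠ 0 := fun h => by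
    rw [h, norm_zero] at hlt
    exact absurd hlt (not_lt.2 hε)
  have : Nontrivial (H →L[ℂ] H) := ⟨_, _, hne⟩
  obtain ⟨k, hk, hk'⟩ := spectrum.exists_nnnorm_eq_spectralRadius (T * Q)
  rw [IsSelfAdjoint.spectralRadius_eq_nnnorm hsa] at hk'
  have hkn : ‖k‖ = ‖T * Q‖ := by
    have := ENNReal.coe_injective hk'
    exact congrArg NNReal.toReal this
  have hkε : ε < ‖k‖ := hkn ▸ hlt
  have hk0 : k ≠ 0 := norm_pos_iff.1 (hε.trans_lt hkε)
  have hcTQ : IsCompactOperator (T * Q : H →L[ℂ] H) := hc.comp_clm Q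
  obtain ⟨x, hx⟩ := ((hcTQ.hasEigenvalue_iff_mem_spectrum hk0).2 hk).exists_hasEigenvector
  have hx1 : T (Q x) = k • x := hx.apply_eq_smul
  have hQi : ∀ y, Q (Q y) = Q y := fun y =>
    Submodule.starProjection_eq_self_iff.2 (Submodule.starProjection_apply_mem _ _)
  have hx2 : Q (T (Q x)) = T (Q x) := by
    have := congrArg (fun S : H →L[ℂ] H => S (Q x)) hcomm.eq
    change T (Q (Q x)) = Q (T (Q x)) at this
    rw [← this, hQi]
  have hQx : Q x = x := by
    rw [hx1, map_smul] at hx2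
    exact smul_right_injective H hk0 hx2
  rw [hQx] at hx1
  have hxU : x ∈ U := hle (mem_largeEigenspace hkε hx1)
  have hxU' : x ∈ Uᗮ := Submodule.starProjection_eq_self_iff.1 hQx
  exact hx.2 (inner_self_eq_zero.1 ((Submodule.mem_orthogonal _ _).1 hxU' x hxU))

/-- Compressing to the complement of a `d`-dimensional subspace bounds `μ_n` for `n ≥ 2 d`. -/
theorem singularValue_le_norm_compression (X : H →L[ℂ] H) {U : Submodule ℂ H}
    [U.HasOrthogonalProjection] {d n : ℕ} (hd : Module.rank ℂ U ≤ d) (hn : 2 * d ≤ n) :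
    singularValue X n ≤ ‖Uᗮ.starProjection * X * Uᗮ.starProjection‖ := by
  have hrank : LinearMap.rank (U.starProjection : H →ₗ[ℂ] H) ≤ (d : Cardinal) := by
    rw [LinearMap.rank]
    have : LinearMap.range (U.starProjection : H →ₗ[ℂ] H) = U := Submodule.range_starProjection U
    rwa [this]
  -- With `p` the projection onto `U`, this operator `p X + (1 - p) X p` is what remains of `X`
  -- after removing its compression.
  have hR : LinearMap.rank ((U.starProjection * X +
      Uᗮ.starProjection * X * U.starProjection : H →L[ℂ] H) : H →ₗ[ℂ] H) ≤ (n : Cardinal) := by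
    have h1 : LinearMap.rank ((U.starProjection : H →ₗ[ℂ] H) ∘ₗ (X : H →ₗ[ℂ] H)) ≤ (d : Cardinal) :=
      (LinearMap.rank_comp_le_left _ _).trans hrank
    have h2 : LinearMap.rank (((Uᗮ.starProjection * X : H →L[ℂ] H) : H →ₗ[ℂ] H) ∘ₗ
        (U.starProjection : H →ₗ[ℂ] H)) ≤ (d : Cardinal) :=
      (LinearMap.rank_comp_le_right _ _).trans hrank
    refine (LinearMap.rank_add_le _ _).trans ((add_le_add h1 h2).trans ?_)
    rw [← two_mul]
    exact_mod_cast hn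
  refine (singularValue_le hR).trans (le_of_eq ?_)
  congr 1
  rw [Submodule.starProjection_orthogonal']
  noncomm_ring

/-- A compact resolvent forces a finite-dimensional kernel. -/
theorem exists_rank_kernel_le [CompleteSpace H] {D : H →ₗ.[ℂ] H} (hR : HasCompactResolvent D) :
    ∃ d : ℕ, Module.rank ℂ (kernel D) ≤ d := by
  obtain ⟨z, R, hRc, hR1, -⟩ := hR
  -- The kernel is trivial if `z = 0`; otherwise it lies in the eigenspace of the compact `R` for
  -- `-1/z`.
  have hker : ∀ k ∈ kernel D, -(z • R k) = k := fun k hk => by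
    obtain ⟨h, hk0⟩ := mem_kernel.1 hk
    simpa [hk0] using hR1 ⟨k, h⟩
  rcases eq_or_ne z 0 with rfl | hz
  · have : kernel D = ⊥ := (Submodule.eq_bot_iff _).2 fun k hk => by simpa using (hker k hk).symm
    exact ⟨0, by rw [this]; simp⟩
  · have hfin := ContinuousLinearMap.finite_dimensional_eigenspace hRc (-z⁻¹)
      (neg_ne_zero.2 (inv_ne_zero hz))
    have hle : kernel D ≤ Module.End.eigenspace R.toLinearMap (-z⁻¹) := fun k hk => by
      rw [Module.End.mem_eigenspace_iff]
      change R k = -z⁻¹ • k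
      nth_rw 2 [← hker k hk]
      rw [neg_smul, smul_neg, neg_neg, smul_smul, inv_mul_cancel₀ hz, one_smul]
    have := Submodule.finiteDimensional_of_le hle
    exact ⟨Module.finrank ℂ (kernel D), (Module.finrank_eq_rank ℂ (kernel D)).ge⟩

/-- The bound `μ_n(T) ≤ M (n + 1)^{-1/r}` for all `n` gives `T ∈ ℒ_{r,∞}` and `‖T‖_{r,∞} ≤ M`. -/
theorem memWeakSchatten_and_weakSchattenNorm_le [CompleteSpace H] {T : H →L[ℂ] H} {r M : ℝ}
    (hr : 0 < r)
    (h : ∀ n : ℕ, singularValue T n ≤ M * ((n : ℝ) + 1) ^ (-(1 / r))) :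
    MemWeakSchatten r T ∧ weakSchattenNorm r T ≤ M := by
  have hr' : 0 < 1 / r := by positivity
  have hM : 0 ≤ M := by simpa using (singularValue_nonneg T 0).trans (h 0)
  -- At `n = 0` the right-hand power is `0` by convention, so that index is excluded.
  have hle : ∀ n : ℕ, n ≠ 0 → singularValue T n ≤ M * (n : ℝ) ^ (-(1 / r)) := fun n hn =>
    (h n).trans (mul_le_mul_of_nonneg_left
      (Real.rpow_le_rpow_of_nonpos (by positivity) (by linarith) (by linarith)) hM)
  have hO : (fun j : ℕ => singularValue T j) =O[Filter.atTop]
      fun j : ℕ => (j : ℝ) ^ (-(1 / r)) := by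
    refine Asymptotics.IsBigO.of_bound M ?_
    filter_upwards [Filter.eventually_ne_atTop 0] with n hn
    rw [Real.norm_of_nonneg (singularValue_nonneg T n), Real.norm_of_nonneg (by positivity)]
    exact hle n hn
  refine ⟨⟨isCompactOperator_of_tendsto_singularValue (hO.trans_tendsto ?_), hO⟩,
    ciSup_le fun n => ?_⟩
  · exact (tendsto_rpow_neg_atTop hr').comp tendsto_natCast_atTop_atTop
  · have hp : (0 : ℝ) < ((n : ℝ) + 1) ^ (1 / r) := by positivity
    calc ((n : ℝ) + 1) ^ (1 / r) * singularValue T n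
        ≤ ((n : ℝ) + 1) ^ (1 / r) * (M * ((n : ℝ) + 1) ^ (-(1 / r))) := by gcongr; exact h n
      _ = M := by
        rw [Real.rpow_neg (by positivity)]
        field_simp

end SingularValues

/-! ### From compressions to the weak Schatten estimate -/

/-- The singular values of `[|D|^{-q}, a]`, estimated by those of `D⁻¹`. -/
theorem singularValue_lie_absNegPow_le {H : Type*} [NormedAddCommGroup H] [InnerProductSpace ℂ H]
    [CompleteSpace H] {D : H →ₗ.[ℂ] H} {A : Type*} [Ring A] [StarRing A] [Algebra ℂ A]
    [StarModule ℂ A] {π : A →⋆ₐ[ℂ] (H →L[ℂ] H)} (h : IsSpectralTriple π D)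
    (hc : IsCompactOperator (partialInverse D)) {d j n : ℕ} {ε q C : ℝ}
    (hd : Module.rank ℂ (kernel D) ≤ d) (hj : singularValue (partialInverse D) j < ε)
    (hn : 2 * (d + j) ≤ n) (a : A)
    (hC : ∀ Q : H →L[ℂ] H, Commute (partialInverse D) Q → IsIdempotentElem Q → ‖Q‖ ≤ 1 →
      ‖partialInverse D * Q‖ ≤ ε →
      Q * ⁅partialInverse D ^ 2, π a⁆ * Q =
        -(partialInverse D ^ 2 * Q * boundedCommutator D (π a) * (partialInverse D * Q) +
          partialInverse D * Q * boundedCommutator D (π a) * (partialInverse D ^ 2 * Q)) →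
      ‖Q * ⁅absNegPow D q, π a⁆ * Q‖ ≤ C) :
    singularValue ⁅absNegPow D q, π a⁆ n ≤ C := by
  have hB := isSelfAdjoint_partialInverse h.isSelfAdjoint h.hasCompactResolvent
  have hBs := ContinuousLinearMap.isSelfAdjoint_iff_isSymmetric.1 hB
  have hε : 0 ≤ ε := (singularValue_nonneg _ j).trans hj.le
  -- Including the kernel makes the complementary projection annihilate `P`, as the compression
  -- formula requires.
  set U := kernel D ⊔ largeEigenspace (partialInverse D) ε with hU
  have hrank : Module.rank ℂ U ≤ (d + j : ℕ) := by
    push_cast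
    exact (Submodule.rank_add_le_rank_add_rank _ _).trans
      (add_le_add hd (rank_largeEigenspace_le hBs hj))
  have : FiniteDimensional ℂ U :=
    Module.rank_lt_aleph0_iff.1 (hrank.trans_lt Cardinal.natCast_lt_aleph0)
  have : CompleteSpace (kernel D) := (isClosed_kernel h.isSelfAdjoint).completeSpace_coe
  have hmap : ∀ x ∈ U, partialInverse D x ∈ U := fun x hx => by
    obtain ⟨k, hk, v, hv, rfl⟩ := Submodule.mem_sup.1 hx
    rw [map_add, partialInverse_kernel h.isSelfAdjoint h.hasCompactResolvent hk, zero_add]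
    exact Submodule.mem_sup_right (map_mem_largeEigenspace hv)
  refine (singularValue_le_norm_compression _ hrank hn).trans ?_
  have hcomm := commute_starProjection_orthogonal hBs hmap
  have hQP : Uᗮ.starProjection * (kernel D).starProjection = 0 := by
    ext x
    exact (Submodule.starProjection_apply_eq_zero_iff _).2 (Submodule.le_orthogonal_orthogonal _
      (Submodule.mem_sup_left (Submodule.starProjection_apply_mem _ x)))
  have hPQ : (kernel D).starProjection * Uᗮ.starProjection = 0 := by
    ext x
    exact (Submodule.starProjection_apply_eq_zero_iff _).2 (Submodule.orthogonal_le le_sup_left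
      (Submodule.starProjection_apply_mem _ x))
  exact hC _ hcomm (Submodule.isIdempotentElem_starProjection _) (Submodule.starProjection_norm_le _)
    (norm_mul_starProjection_orthogonal_le hB hc hmap hε le_sup_right)
    (compression_lie_partialInverse_sq h a hcomm hQP hPQ)

end SpectralTriple

end

theorem mainTheorem5 {H : Type*} [NormedAddCommGroup H] [InnerProductSpace ℂ H] [CompleteSpace H]
    [TopologicalSpace.SeparableSpace H] (D : H →ₗ.[ℂ] H) (p : ℝ) (hp : 0 < p)
    (hD : SpectralTriple.IsSummable p D) (q : ℝ) (hq : 0 < q) :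
    ∃ C : ℝ, 0 < C ∧
      ∀ (A : Type*) [Ring A] [StarRing A] [Algebra ℂ A] [StarModule ℂ A]
        (π : A →⋆ₐ[ℂ] (H →L[ℂ] H)), SpectralTriple.IsSpectralTriple π D → ∀ a : A,
          SpectralTriple.MemWeakSchatten (p / (q + 1)) ⁅SpectralTriple.absNegPow D q, π a⁆ ∧
          SpectralTriple.weakSchattenNorm (p / (q + 1)) ⁅SpectralTriple.absNegPow D q, π a⁆ ≤
            C * ‖SpectralTriple.boundedCommutator D (π a)‖ := by
  open SpectralTriple in
  -- The constant is chosen before any triple is given; if `D` lacks these properties there is no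
  -- triple and any constant works.
  by_cases hDR : IsSelfAdjoint D ∧ HasCompactResolvent D
  swap
  · exact ⟨1, one_pos, fun A _ _ _ _ π h => absurd ⟨h.isSelfAdjoint, h.hasCompactResolvent⟩ hDR⟩
  obtain ⟨hsa, hR⟩ := hDR
  have : CompleteSpace (kernel D) := (isClosed_kernel hsa).completeSpace_coe
  obtain ⟨hc, hO⟩ := hD
  obtain ⟨c, hc0, hcb⟩ := Asymptotics.bound_of_isBigO_nat_atTop hO
  obtain ⟨d, hd⟩ := exists_rank_kernel_le hR
  obtain ⟨C₁, hC₁, hcomp⟩ := exists_norm_compression_lie_absPow_le hq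
  obtain ⟨C₂, hC₂, hnorm⟩ := exists_norm_lie_absNegPow_le hsa hR hq
  have hK : (0 : ℝ) < 4 + 2 * d := by positivity
  set s : ℝ := (q + 1) / p with hs
  have hs0 : 0 < s := by positivity
  -- The first summand serves large `n`, `C₂` serves small `n`, and the last factor pays for
  -- replacing `j` (or `1`) by `n + 1`.
  refine ⟨(C₁ * (2 * c) ^ (q + 1) + C₂) * (4 + 2 * (d : ℝ)) ^ s, by positivity,
    fun A _ _ _ _ π h a => memWeakSchatten_and_weakSchattenNorm_le (by positivity) fun n => ?_⟩
  rw [one_div_div, ← hs]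
  set e := ‖boundedCommutator D (π a)‖ with he
  have he0 : 0 ≤ e := norm_nonneg _
  have hscale : ∀ x : ℝ, 0 < x → (n : ℝ) + 1 ≤ (4 + 2 * d) * x →
      x ^ (-s) ≤ (4 + 2 * (d : ℝ)) ^ s * ((n : ℝ) + 1) ^ (-s) := fun x hx hnx => by
    rw [Real.rpow_neg hx.le, Real.rpow_neg (by positivity), ← div_eq_mul_inv,
      inv_le_iff_one_le_mul₀ (by positivity), div_mul_eq_mul_div, one_le_div (by positivity),
      ← Real.mul_rpow hK.le hx.le]
    exact Real.rpow_le_rpow (by positivity) hnx hs0.le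
  rcases le_or_gt (2 * (d + 1)) n with hn | hn
  -- The largest `j` with `2 (d + j) ≤ n`; the case assumption makes it at least `1`, so the
  -- subtraction does not truncate.
  · obtain ⟨j, hj⟩ : ∃ j, j = n / 2 - d := ⟨_, rfl⟩
    have hj1 : 1 ≤ j := by omega
    have hj0 : (0 : ℝ) < j := by exact_mod_cast hj1
    have hnj : (n : ℝ) + 1 ≤ (4 + 2 * d) * j := by
      have h1 : n + 1 ≤ 2 * j + 2 + 2 * d := by omega
      have h2 : (n : ℝ) + 1 ≤ 2 * j + 2 + 2 * d := by exact_mod_cast h1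
      have h3 : (1 : ℝ) ≤ j := by exact_mod_cast hj1
      nlinarith [(Nat.cast_nonneg d : (0 : ℝ) ≤ d)]
    have hx : (0 : ℝ) < (j : ℝ) ^ (-(1 / p)) := by positivity
    -- Doubling `c` turns the bound into the strict inequality that the rank estimate needs.
    have hμ : singularValue (partialInverse D) j < 2 * c * (j : ℝ) ^ (-(1 / p)) := by
      have := hcb (x := j) hx.ne'
      rw [Real.norm_of_nonneg (singularValue_nonneg _ _), Real.norm_of_nonneg hx.le] at this
      nlinarith [mul_pos hc0 hx]
    have hε : (2 * c * (j : ℝ) ^ (-(1 / p))) ^ (q + 1) = (2 * c) ^ (q + 1) * (j : ℝ) ^ (-s) := by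
      rw [Real.mul_rpow (by positivity) hx.le, ← Real.rpow_mul hj0.le, hs]
      congr 2
      field_simp
    have hmain : singularValue ⁅absNegPow D q, π a⁆ n ≤
        C₁ * (2 * c * (j : ℝ) ^ (-(1 / p))) ^ (q + 1) * e :=
      singularValue_lie_absNegPow_le h hc hd hμ (by omega) a fun Q h1 h2 h3 h4 h5 =>
        hcomp _ _ Q _ _ _ (isSelfAdjoint_partialInverse hsa hR) h1 h2 h3 (by positivity) h4 h5
    calc _ ≤ _ := hmain
      _ = C₁ * (2 * c) ^ (q + 1) * (j : ℝ) ^ (-s) * e := by rw [hε]; ring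
      _ ≤ (C₁ * (2 * c) ^ (q + 1) + C₂) * ((4 + 2 * (d : ℝ)) ^ s * ((n : ℝ) + 1) ^ (-s)) * e := by
        gcongr
        · linarith
        · exact hscale _ hj0 hnj
      _ = _ := by ring
  · have hn1 : (n : ℝ) + 1 ≤ (4 + 2 * d) * 1 := by
      have h1 : n + 1 ≤ 4 + 2 * d := by omega
      rw [mul_one]
      exact_mod_cast h1
    have h1 := hscale 1 one_pos hn1
    rw [Real.one_rpow] at h1
    calc _ ≤ C₂ * e := (singularValue_le_norm _ n).trans (hnorm A π h a)
      _ = C₂ * 1 * e := by ring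
      _ ≤ (C₁ * (2 * c) ^ (q + 1) + C₂) * ((4 + 2 * (d : ℝ)) ^ s * ((n : ℝ) + 1) ^ (-s)) * e := by
        gcongr
        have : 0 ≤ C₁ * (2 * c) ^ (q + 1) := by positivity
        linarith
      _ = _ := by ring
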